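/- There is an absolute constant $C>0$ such that the following holds. Let $\mathcal G=(\mathcal V,\mathcal E)$ be a finite simple graph with $n=|\mathcal V|$ vertices, and let $D=\max\{1,\max_{v\in\mathcal V}d(v)\}$, where $d(v)$ is the degree of $v$ (so $D$ is the maximal degree of $\mathcal G$ as soon as $\mathcal G$ has an edge). Let $\{X_i, i\in\mathcal V\}$ be real random variables on a probability space for which $\mathcal G$ is a dependency graph: for all disjoint $\Gamma_1,\Gamma_2\subset\mathcal V$ such that no edge of $\mathcal G$ has one endpoint in $\Gamma_1$ and the other in $\Gamma_2$, the families $\{X_i, i\in\Gamma_1\}$ and $\{X_i, i\in\Gamma_2\}$ are independent. Assume that $\mathbb E X_i=0$ and $|X_i|\le B$ almost surely for each $i\in\mathcal V$, and that $\sigma^2=\operatorname{Var}\bigl(\sum_{i\in\mathcal V}X_i\bigr)>0$ with $\sigma>0$. Put $W=\sum_{i\in\mathcal V}X_i/\sigma$ and let $\Phi$ be the standard normal distribution function. Then $$\sup_{z\in\mathbb R}\bigl|\mathbb P(W\le z)-\Phi(z)\bigr|\le C B^2\sigma^{-2}n^{1/2}D^{3/2},$$ and, for every $z\ge 0$ such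 that $\bigl\{B^2\sigma^{-2}n^{1/2}D^{3/2}+B^3\sigma^{-3}nD^2z\bigr\}(1+z^2)\le 1$, $$\Bigl|\frac{\mathbb P(W>z)}{1-\Phi(z)}-1\Bigr|\le C\bigl\{B^2\sigma^{-2}n^{1/2}D^{3/2}+B^3\sigma^{-3}nD^2z\bigr\}(1+z^2).$$ -/

import Mathlib

open MeasureTheory ProbabilityTheory

/-- `G` is a dependency graph for the family `X` under `P`: whenever `Γ₁` and `Γ₂` are disjoint
sets of vertices with no edge of `G` between them, the subfamilies `(X i)_{i ∈ Γ₁}` and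
`(X i)_{i ∈ Γ₂}` (as random vectors) are independent. -/
def IsDependencyGraph {Ω V : Type*} [MeasurableSpace Ω] (P : Measure Ω)
    (G : SimpleGraph V) (X : V → Ω → ℝ) : Prop :=
  ∀ Γ₁ Γ₂ : Set V, Disjoint Γ₁ Γ₂ → (∀ i ∈ Γ₁, ∀ j ∈ Γ₂, ¬ G.Adj i j) →
    IndepFun (fun ω (i : Γ₁) => X i ω) (fun ω (j : Γ₂) => X j ω) P

/-- The standard normal distribution function `Φ`. -/
noncomputable def stdNormalCDF (z : ℝ) : ℝ := cdf (gaussianReal 0 1) z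

/-- `σ`, the standard deviation of `∑ i, X i`. -/
noncomputable def sumStdDev {Ω V : Type*} [MeasurableSpace Ω] [Fintype V] (P : Measure Ω)
    (X : V → Ω → ℝ) : ℝ :=
  √(variance (fun ω => ∑ i, X i ω) P)

/-- `W = ∑ i, X i / σ`. -/
noncomputable def normalizedSum {Ω V : Type*} [MeasurableSpace Ω] [Fintype V] (P : Measure Ω)
    (X : V → Ω → ℝ) (ω : Ω) : ℝ :=
  ∑ i, X i ω / sumStdDev P X

/-- The maximal degree of `G`, replaced by `1` if `G` has no edge. -/
def posMaxDegree {V : Type*} [Fintype V] (G : SimpleGraph V) [DecidableRel G.Adj] : ℕ :=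
  max G.maxDegree 1

/-- The rate `B² σ⁻² n^{1/2} D^{3/2}`. -/
noncomputable def uniformRate (B σ : ℝ) (n D : ℕ) : ℝ :=
  B ^ 2 * (σ ^ 2)⁻¹ * (n : ℝ) ^ (1 / 2 : ℝ) * (D : ℝ) ^ (3 / 2 : ℝ)

/-- The rate `{B² σ⁻² n^{1/2} D^{3/2} + B³ σ⁻³ n D² z} (1 + z²)`. -/
noncomputable def moderateRate (B σ : ℝ) (n D : ℕ) (z : ℝ) : ℝ :=
  (uniformRate B σ n D + B ^ 3 * (σ ^ 3)⁻¹ * (n : ℝ) * (D : ℝ) ^ 2 * z) * (1 + z ^ 2)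

/-! ### Decoupling and Taylor estimates for locally dependent vectors. -/

section LocalDependence

set_option linter.unusedSectionVars false

variable {V : Type*} [Fintype V] [DecidableEq V]

/-! Write `b = B / σ` and let `r` be the uniform rate, so that `r ^ 2 = n D³ b⁴`. The proof is
Stein's method carried one order further than usual. Repeated decoupling (`exists_stein_expansion`)
gives `E[W g(W)] = E[g'(W)] + γ E[g''(W)]` up to a remainder of order `n D³ b⁴`, that is `r²`, times
a local supremum of `|g'''|`. A direct estimate of `γ` gives only `n D² b³`, which may be much
larger than `r`. The decisive point is `abs_coeff_le`: since `W` is centred, its moment generating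
function `φ` satisfies `a φ'(a) ≥ 0`; testing the expansion on exponentials with `a = ±1/ε` then
forces `|γ| ≤ 4ε`, where `ε` is a multiple of `r`.

From there only the structure `SteinExpansion` matters. Inserting `g(w) = exp(a w) f(w - a)` turns
the expansion into a Stein identity for the exponential tilt of `W`, recentred at `a`. A smoothing
argument that bounds the Kolmogorov distance in terms of itself (`exists_kolmogorov_bound`) shows
that this tilt is normal up to `O(ε (1 + a)²)`; `a = 0` is the uniform bound.

For the tail, take `a = z`. Undoing the tilt expresses `P(W > z)` through `φ(z)` and the integral of
`exp(-z y)` over `y > 0` under the tilted law. The first is `exp(z²/2 + O(ε z³))` by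
`abs_log_mgf_sub_le`. The second differs from its Gaussian value by `O(ε z²)`, and that value is at
least `c / z`, so the total relative error is `O(ε z³)` (`exists_moderate_bound`). Finally `r ≤ 2 n
D² b³`, a consequence of `Var W = 1`, converts this to the stated rate, while bounded `z` follow
from the uniform bound. -/

/-- The union of the neighbourhoods `A i` of the vertices of a list. -/
def listNbhd (A : V → Finset V) (l : List V) : Finset V := l.toFinset.biUnion A

/-- `μ` is the law of a centred vector with coordinates bounded by `b`, and, for every list of at
most `m`-element neighbourhoods `A i`, the coordinates in the list are independent of the sum of the
coordinates outside of the neighbourhoods. -/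
structure LocallyDependent (μ : Measure (V → ℝ)) (A : V → Finset V) (m : ℕ) (b : ℝ) : Prop where
  nonneg : 0 ≤ b
  bound : ∀ i, ∀ᵐ x ∂μ, |x i| ≤ b
  mean : ∀ i, ∫ x, x i ∂μ = 0
  card_le : ∀ i, (A i).card ≤ m
  decouple : ∀ (l : List V) (g : ℝ → ℝ), Continuous g →
    ∫ x, (l.map x).prod * g (∑ k, x k - ∑ k ∈ listNbhd A l, x k) ∂μ =
      (∫ x, (l.map x).prod ∂μ) * ∫ x, g (∑ k, x k - ∑ k ∈ listNbhd A l, x k) ∂μ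

theorem integrable_of_continuous_of_ae_bound {V : Type*} [Fintype V] {μ : Measure (V → ℝ)}
    [IsFiniteMeasure μ] {b : ℝ} (hb : ∀ i, ∀ᵐ x ∂μ, |x i| ≤ b) {F : (V → ℝ) → ℝ}
    (hF : Continuous F) : Integrable F μ := by
  have hK : IsCompact (Set.pi Set.univ fun _ : V => Set.Icc (-b) b) :=
    isCompact_univ_pi fun _ => isCompact_Icc
  obtain ⟨C, hC⟩ := hK.exists_bound_of_continuousOn hF.continuousOn
  refine Integrable.of_bound hF.measurable.aestronglyMeasurable C ?_
  filter_upwards [ae_all_iff.2 hb] with x hx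
  exact hC x fun i _ => abs_le.1 (hx i)

theorem taylor_bound_one {g g' : ℝ → ℝ} (h : ∀ w, HasDerivAt g (g' w) w) {w y K : ℝ}
    (hK : ∀ u, |u| ≤ |y| → |g' (w + u)| ≤ K) : |g w - g (w - y)| ≤ |y| * K := by
  have := (convex_uIcc w (w - y)).norm_image_sub_le_of_norm_hasDerivWithin_le (f := g) (f' := g')
    (C := K) (fun x _ => (h x).hasDerivWithinAt) (fun x hx => by
      have := hK (x - w) (by
        rw [Set.mem_uIcc] at hx
        rcases hx with hx | hx
        · rw [abs_of_nonneg (by linarith), abs_of_nonpos (by linarith)]; linarith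
        · rw [abs_of_nonpos (by linarith), abs_of_nonneg (by linarith)]; linarith)
      simpa using this) Set.right_mem_uIcc Set.left_mem_uIcc
  simpa [mul_comm] using this

/-- The mean value inequality is applied to `g` minus its tangent at `w`, whose derivative is
controlled by the previous order. Factorials are dropped, here and at order three. -/
theorem taylor_bound_two {g g1 g2 : ℝ → ℝ} (h : ∀ w, HasDerivAt g (g1 w) w)
    (h1 : ∀ w, HasDerivAt g1 (g2 w) w) {w y K : ℝ}
    (hK : ∀ u, |u| ≤ |y| → |g2 (w + u)| ≤ K) :
    |g w - g (w - y) - y * g1 w| ≤ |y| ^ 2 * K := by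
  have hK0 : 0 ≤ K := (abs_nonneg _).trans (hK 0 (by simp))
  have h' : ∀ v, HasDerivAt (fun v => g v - (v - w) * g1 w) (g1 v - g1 w) v := fun v => by
    exact ((h v).fun_sub (((hasDerivAt_id' v).sub_const w).mul_const (g1 w))).congr_deriv (by simp)
  have := taylor_bound_one h' (w := w) (y := y) (K := |y| * K) (fun u hu => by
    have h2 := taylor_bound_one h1 (w := w) (y := -u) (K := K)
      (fun s hs => hK s (hs.trans (by simpa using hu)))
    rw [abs_neg, sub_neg_eq_add, abs_sub_comm] at h2
    exact h2.trans (by gcongr))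
  refine le_trans (le_of_eq ?_) (this.trans (by rw [pow_two, mul_assoc]))
  congr 1; ring

theorem taylor_bound_three {g g1 g2 g3 : ℝ → ℝ} (h : ∀ w, HasDerivAt g (g1 w) w)
    (h1 : ∀ w, HasDerivAt g1 (g2 w) w) (h2 : ∀ w, HasDerivAt g2 (g3 w) w) {w y K : ℝ}
    (hK : ∀ u, |u| ≤ |y| → |g3 (w + u)| ≤ K) :
    |g w - g (w - y) - y * g1 w + y ^ 2 / 2 * g2 w| ≤ |y| ^ 3 * K := by
  have hK0 : 0 ≤ K := (abs_nonneg _).trans (hK 0 (by simp))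
  have h' : ∀ v, HasDerivAt (fun v => g v - (v - w) * g1 w - (v - w) ^ 2 / 2 * g2 w)
      (g1 v - g1 w - (v - w) * g2 w) v := fun v => by
    have e := ((((hasDerivAt_id' v).sub_const w).fun_pow 2).div_const 2).mul_const (g2 w)
    exact (((h v).fun_sub (((hasDerivAt_id' v).sub_const w).mul_const (g1 w))).fun_sub e).congr_deriv
      (by simp)
  have := taylor_bound_one h' (w := w) (y := y) (K := |y| ^ 2 * K) (fun u hu => by
    have h3 := taylor_bound_two h1 h2 (w := w) (y := -u) (K := K)
      (fun s hs => hK s (hs.trans (by simpa using hu)))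
    rw [abs_neg, sub_neg_eq_add] at h3
    refine le_trans (le_of_eq ?_) (h3.trans (by gcongr))
    rw [← abs_neg]; congr 1; ring)
  refine le_trans (le_of_eq ?_) (this.trans (le_of_eq (by ring)))
  congr 1; ring

namespace LocallyDependent

variable {μ : Measure (V → ℝ)} [IsProbabilityMeasure μ] {A : V → Finset V} {m : ℕ} {b : ℝ}

theorem integrable (H : LocallyDependent μ A m b) {F : (V → ℝ) → ℝ} (hF : Continuous F) :
    Integrable F μ :=
  integrable_of_continuous_of_ae_bound H.bound hF

theorem card_listNbhd_le (H : LocallyDependent μ A m b) (l : List V) :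
    ((listNbhd A l).card : ℝ) ≤ l.length * m := by
  have : (listNbhd A l).card ≤ l.length * m :=
    (Finset.card_biUnion_le_card_mul _ _ m fun i _ => H.card_le i).trans
      (Nat.mul_le_mul_right m l.toFinset_card_le)
  exact_mod_cast this

theorem abs_sum_le (H : LocallyDependent μ A m b) (l : List V) :
    ∀ᵐ x ∂μ, |∑ k ∈ listNbhd A l, x k| ≤ l.length * m * b := by
  filter_upwards [ae_all_iff.2 H.bound] with x hx
  calc |∑ k ∈ listNbhd A l, x k| ≤ ∑ k ∈ listNbhd A l, |x k| := Finset.abs_sum_le_sum_abs _ _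
    _ ≤ ∑ k ∈ listNbhd A l, b := Finset.sum_le_sum fun k _ => hx k
    _ = (listNbhd A l).card * b := by simp
    _ ≤ _ := by gcongr; exacts [H.nonneg, H.card_listNbhd_le l]

theorem abs_prod_le (H : LocallyDependent μ A m b) (l : List V) :
    ∀ᵐ x ∂μ, |(l.map x).prod| ≤ b ^ l.length := by
  filter_upwards [ae_all_iff.2 H.bound] with x hx
  induction l with
  | nil => simp
  | cons i l ih =>
    simp only [List.map_cons, List.prod_cons, List.length_cons, abs_mul, pow_succ']
    exact mul_le_mul (hx i) ih (abs_nonneg _) H.nonneg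

theorem continuous_prod (l : List V) : Continuous fun x : V → ℝ => (l.map x).prod := by
  induction l with
  | nil => simpa using continuous_const
  | cons i l ih => simp only [List.map_cons, List.prod_cons]; fun_prop

/-- With the neighbourhood removed from the argument of `g` the expectation factorises exactly.
Removing it and putting it back costs only the two terms in increments of `g`. -/
theorem decouple_identity (H : LocallyDependent μ A m b) (l : List V) {g : ℝ → ℝ}
    (hg : Continuous g) :
    ∫ x, (l.map x).prod * g (∑ k, x k) ∂μ =
      (∫ x, (l.map x).prod ∂μ) * (∫ x, g (∑ k, x k) ∂μ) +
      ∫ x, (l.map x).prod * (g (∑ k, x k) - g (∑ k, x k - ∑ k ∈ listNbhd A l, x k)) ∂μ -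
      (∫ x, (l.map x).prod ∂μ) *
        ∫ x, (g (∑ k, x k) - g (∑ k, x k - ∑ k ∈ listNbhd A l, x k)) ∂μ := by
  have hp := continuous_prod l
  have e := H.decouple l g hg
  have e1 : ∫ x, (l.map x).prod *
      (g (∑ k, x k) - g (∑ k, x k - ∑ k ∈ listNbhd A l, x k)) ∂μ =
      ∫ x, (l.map x).prod * g (∑ k, x k) ∂μ -
        ∫ x, (l.map x).prod * g (∑ k, x k - ∑ k ∈ listNbhd A l, x k) ∂μ := by
    rw [← integral_sub (H.integrable (by fun_prop)) (H.integrable (by fun_prop))]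
    simp only [mul_sub]
  rw [e1, integral_sub (H.integrable (by fun_prop)) (H.integrable (by fun_prop)), e]
  ring

theorem abs_integral_le_of_bound {F G : (V → ℝ) → ℝ} (hG : Integrable G μ) {K : ℝ}
    (h : ∀ᵐ x ∂μ, |F x| ≤ K * G x) : |∫ x, F x ∂μ| ≤ K * ∫ x, G x ∂μ := by
  rw [← integral_const_mul]
  exact norm_integral_le_of_norm_le (f := F) (hG.const_mul K) h

theorem abs_integral_prod_le (H : LocallyDependent μ A m b) (l : List V) :
    |∫ x, (l.map x).prod ∂μ| ≤ b ^ l.length := by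
  have := abs_integral_le_of_bound (μ := μ) (integrable_const (1 : ℝ)) (K := b ^ l.length)
    (by simpa using H.abs_prod_le l)
  simpa [measureReal_def] using this

/-- Decoupling of a product of few coordinates from a Lipschitz function of the sum. -/
theorem abs_integral_prod_mul_sub_le (H : LocallyDependent μ A m b) (l : List V) {g g' M : ℝ → ℝ}
    (h : ∀ w, HasDerivAt g (g' w) w) {ρ : ℝ} (hl : l.length * m * b ≤ ρ)
    (hM : ∀ w u, |u| ≤ ρ → |g' (w + u)| ≤ M w) (hMi : Integrable (fun x => M (∑ k, x k)) μ) :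
    |∫ x, (l.map x).prod * g (∑ k, x k) ∂μ -
      (∫ x, (l.map x).prod ∂μ) * ∫ x, g (∑ k, x k) ∂μ| ≤
      2 * (b ^ l.length * (l.length * m * b)) * ∫ x, M (∑ k, x k) ∂μ := by
  have hb := H.nonneg
  have hg : Continuous g := continuous_iff_continuousAt.2 fun w => (h w).continuousAt
  rw [H.decouple_identity l hg, add_sub_assoc, add_sub_cancel_left]
  have hd : ∀ᵐ x ∂μ, |g (∑ k, x k) - g (∑ k, x k - ∑ k ∈ listNbhd A l, x k)| ≤
      l.length * m * b * M (∑ k, x k) := by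
    filter_upwards [H.abs_sum_le l] with x hx
    have hM0 : 0 ≤ M (∑ k, x k) :=
      (abs_nonneg _).trans (hM _ 0 (by simpa using le_trans (by positivity) hl))
    exact (taylor_bound_one h fun u hu => hM _ u (hu.trans (hx.trans hl))).trans (by gcongr)
  have h1 := abs_integral_le_of_bound (F := fun x => (l.map x).prod *
      (g (∑ k, x k) - g (∑ k, x k - ∑ k ∈ listNbhd A l, x k))) hMi
      (K := b ^ l.length * (l.length * m * b)) (by
    filter_upwards [hd, H.abs_prod_le l] with x hx hp
    rw [abs_mul, mul_assoc]
    gcongr)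
  have h2 := mul_le_mul (H.abs_integral_prod_le l) (abs_integral_le_of_bound hMi hd)
    (abs_nonneg _) (by positivity)
  rw [← abs_mul] at h2
  refine (abs_sub _ _).trans ?_
  linarith

end LocallyDependent
end LocalDependence

/-! ### Third order expansion of Stein's operator. -/

section LocalDependence

set_option linter.unusedSectionVars false

variable {V : Type*} [Fintype V] [DecidableEq V]

namespace LocallyDependent

variable {μ : Measure (V → ℝ)} [IsProbabilityMeasure μ] {A : V → Finset V} {m : ℕ} {b : ℝ}

/-- Each summand `x k` is absorbed into the list, so the first order decoupling applies to `k :: l`.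
-/
theorem abs_integral_prod_mul_sum_sub_le (H : LocallyDependent μ A m b) (l : List V)
    (s : Finset V) {g g' M : ℝ → ℝ}
    (h : ∀ w, HasDerivAt g (g' w) w) {ρ : ℝ} (hl : ((l.length + 1 : ℕ) : ℝ) * m * b ≤ ρ)
    (hM : ∀ w u, |u| ≤ ρ → |g' (w + u)| ≤ M w) (hMi : Integrable (fun x => M (∑ k, x k)) μ) :
    |∫ x, (l.map x).prod * (∑ k ∈ s, x k) * g (∑ k, x k) ∂μ -
      (∫ x, (l.map x).prod * (∑ k ∈ s, x k) ∂μ) * ∫ x, g (∑ k, x k) ∂μ| ≤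
      s.card * (2 * (b ^ (l.length + 1) * ((l.length + 1 : ℕ) * m * b)) *
        ∫ x, M (∑ k, x k) ∂μ) := by
  have hg : Continuous g := continuous_iff_continuousAt.2 fun w => (h w).continuousAt
  have hp := continuous_prod l
  have e1 : ∫ x, (l.map x).prod * (∑ k ∈ s, x k) * g (∑ k, x k) ∂μ =
      ∑ k ∈ s, ∫ x, ((k :: l).map x).prod * g (∑ k, x k) ∂μ := by
    have hc : ∀ k, Continuous fun x : V → ℝ => ((k :: l).map x).prod * g (∑ k, x k) := fun k => by
      have := continuous_prod (k :: l)
      fun_prop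
    rw [← integral_finsetSum _ fun k _ => H.integrable (hc k)]
    congr 1; ext x
    simp only [List.map_cons, List.prod_cons, ← Finset.sum_mul]
    ring
  have e2 : ∫ x, (l.map x).prod * (∑ k ∈ s, x k) ∂μ =
      ∑ k ∈ s, ∫ x, ((k :: l).map x).prod ∂μ := by
    rw [← integral_finsetSum _ fun k _ => H.integrable (continuous_prod (k :: l))]
    congr 1; ext x
    simp only [List.map_cons, List.prod_cons, ← Finset.sum_mul]
    ring
  rw [e1, e2, Finset.sum_mul, ← Finset.sum_sub_distrib, ← nsmul_eq_mul]
  refine (Finset.abs_sum_le_sum_abs _ _).trans (Finset.sum_le_card_nsmul _ _ _ fun k _ => ?_)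
  exact H.abs_integral_prod_mul_sub_le (k :: l) h (by simpa using hl) hM hMi

/-- The increment of `g1` is `(∑ k ∈ N, x k) * g2` plus a quadratic remainder `R`, and its linear
part is decoupled once more. The constant is `24 = 12 + 4 + (4 + 4)`. -/
theorem abs_integral_pair_sub_le (H : LocallyDependent μ A m b) (i j : V) {g1 g2 g3 M : ℝ → ℝ}
    (h1 : ∀ w, HasDerivAt g1 (g2 w) w) (h2 : ∀ w, HasDerivAt g2 (g3 w) w)
    {ρ : ℝ} (hρ : 3 * m * b ≤ ρ)
    (hM : ∀ w u, |u| ≤ ρ → |g3 (w + u)| ≤ M w) (hMi : Integrable (fun x => M (∑ k, x k)) μ) :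
    |∫ x, x i * x j * g1 (∑ k, x k) ∂μ -
      (∫ x, x i * x j ∂μ) * ∫ x, g1 (∑ k, x k) ∂μ -
      (∫ x, x i * x j * ∑ k ∈ listNbhd A [i, j], x k ∂μ) * ∫ x, g2 (∑ k, x k) ∂μ| ≤
      24 * m ^ 2 * b ^ 4 * ∫ x, M (∑ k, x k) ∂μ := by
  have hb := H.nonneg
  have hg1 : Continuous g1 := continuous_iff_continuousAt.2 fun w => (h1 w).continuousAt
  have hg2 : Continuous g2 := continuous_iff_continuousAt.2 fun w => (h2 w).continuousAt
  have hmb : (0 : ℝ) ≤ m * b := by positivity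
  have hM0 : ∀ w, 0 ≤ M w := fun w => (abs_nonneg _).trans (hM w 0 (by simp; nlinarith))
  have hI : 0 ≤ ∫ x, M (∑ k, x k) ∂μ := integral_nonneg fun x => hM0 _
  set I := ∫ x, M (∑ k, x k) ∂μ
  set N := listNbhd A [i, j] with hN
  have hcard : (N.card : ℝ) ≤ 2 * m := by simpa using H.card_listNbhd_le [i, j]
  set R : (V → ℝ) → ℝ := fun x => g1 (∑ k, x k) - g1 (∑ k, x k - ∑ k ∈ N, x k) -
    (∑ k ∈ N, x k) * g2 (∑ k, x k) with hR
  have hRc : Continuous R := by fun_prop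
  have hRb : ∀ᵐ x ∂μ, |R x| ≤ (2 * m * b) ^ 2 * M (∑ k, x k) := by
    filter_upwards [H.abs_sum_le [i, j]] with x hx
    have hx : |∑ k ∈ N, x k| ≤ 2 * m * b := by simpa using hx
    refine (taylor_bound_two h1 h2 fun u hu => hM _ u (hu.trans (hx.trans ?_))).trans ?_
    · linarith
    · have := hM0 (∑ k, x k)
      gcongr
  have hpb : ∀ᵐ x ∂μ, |x i * x j| ≤ b ^ 2 := by simpa using H.abs_prod_le [i, j]
  have hP : |∫ x, x i * x j ∂μ| ≤ b ^ 2 := by simpa using H.abs_integral_prod_le [i, j]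
  have e0 := H.decouple_identity [i, j] hg1
  simp only [List.map_cons, List.map_nil, List.prod_cons, List.prod_nil, mul_one, ← hN] at e0
  have e1 : ∫ x, x i * x j * (g1 (∑ k, x k) - g1 (∑ k, x k - ∑ k ∈ N, x k)) ∂μ =
      ∫ x, x i * x j * (∑ k ∈ N, x k) * g2 (∑ k, x k) ∂μ + ∫ x, x i * x j * R x ∂μ := by
    rw [← integral_add (H.integrable (by fun_prop)) (H.integrable (by fun_prop))]
    congr 1; ext x; simp only [hR]; ring
  have e2 : ∫ x, (g1 (∑ k, x k) - g1 (∑ k, x k - ∑ k ∈ N, x k)) ∂μ =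
      ∫ x, (∑ k ∈ N, x k) * g2 (∑ k, x k) ∂μ + ∫ x, R x ∂μ := by
    rw [← integral_add (H.integrable (by fun_prop)) (H.integrable (by fun_prop))]
    congr 1; ext x; simp only [hR]; ring
  have b1 := H.abs_integral_prod_mul_sum_sub_le [i, j] N h2 (ρ := ρ)
    (by simpa using le_trans (le_of_eq (by norm_num)) hρ) hM hMi
  have b2 := H.abs_integral_prod_mul_sum_sub_le [] N h2 (ρ := ρ)
    (by simp; nlinarith) hM hMi
  simp only [List.map_cons, List.map_nil, List.prod_cons, List.prod_nil, mul_one, one_mul,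
    List.length_cons, List.length_nil] at b1 b2
  -- Centring removes the leading part of the counterterm, which therefore only enters the
  -- remainder.
  have e3 : ∫ x, ∑ k ∈ N, x k ∂μ = 0 := by
    rw [integral_finsetSum _ fun k _ => H.integrable (by fun_prop)]
    simp [H.mean]
  rw [e3, zero_mul, sub_zero] at b2
  have b3 : |∫ x, x i * x j * R x ∂μ| ≤ b ^ 2 * (2 * m * b) ^ 2 * I :=
    abs_integral_le_of_bound hMi (by
      filter_upwards [hRb, hpb] with x hx hp
      rw [abs_mul, mul_assoc]; gcongr)
  have b4 : |∫ x, R x ∂μ| ≤ (2 * m * b) ^ 2 * I := abs_integral_le_of_bound hMi hRb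
  have c1 : (N.card : ℝ) * (2 * (b ^ (0 + 1 + 1 + 1) * ((0 + 1 + 1 + 1 : ℕ) * m * b)) * I) ≤
      12 * m ^ 2 * b ^ 4 * I := by
    calc _ ≤ (2 * m) * (2 * (b ^ (0 + 1 + 1 + 1) * ((0 + 1 + 1 + 1 : ℕ) * m * b)) * I) := by
          gcongr
      _ = _ := by push_cast; ring
  have c2 : (N.card : ℝ) * (2 * (b ^ (0 + 1) * ((0 + 1 : ℕ) * m * b)) * I) ≤
      4 * m ^ 2 * b ^ 2 * I := by
    calc _ ≤ (2 * m) * (2 * (b ^ (0 + 1) * ((0 + 1 : ℕ) * m * b)) * I) := by gcongr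
      _ = _ := by push_cast; ring
  have b5 : |(∫ x, x i * x j ∂μ) * (∫ x, (∑ k ∈ N, x k) * g2 (∑ k, x k) ∂μ + ∫ x, R x ∂μ)| ≤
      b ^ 2 * (4 * m ^ 2 * b ^ 2 * I + (2 * m * b) ^ 2 * I) := by
    rw [abs_mul]
    refine mul_le_mul hP ((abs_add_le _ _).trans (add_le_add (b2.trans c2) b4)) (abs_nonneg _)
      (by positivity)
  rw [e0, e1, e2]
  have b1' := b1.trans c1
  rw [abs_le] at *
  constructor <;> nlinarith

/-- Decoupling with `g = id` is exact: the increment is the neighbourhood sum itself, and the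
product of means vanishes. -/
theorem integral_sq_sum_eq (H : LocallyDependent μ A m b) :
    ∫ x, (∑ k, x k) ^ 2 ∂μ = ∑ i, ∑ j ∈ listNbhd A [i], ∫ x, x i * x j ∂μ := by
  have : ∀ x : V → ℝ, (∑ k, x k) ^ 2 = ∑ i, x i * ∑ k, x k := fun x => by
    rw [pow_two, Finset.sum_mul]
  simp_rw [this]
  rw [integral_finsetSum _ fun k _ => H.integrable (by fun_prop)]
  refine Finset.sum_congr rfl fun i _ => ?_
  have e := H.decouple_identity [i] continuous_id
  simp only [List.map_cons, List.map_nil, List.prod_cons, List.prod_nil, mul_one, H.mean,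
    zero_mul, id, sub_sub_cancel, zero_add, sub_zero] at e
  rw [e, ← integral_finsetSum _ fun k _ => H.integrable (by fun_prop)]
  simp only [Finset.mul_sum]

theorem integral_sq_sum_le (H : LocallyDependent μ A m b) :
    ∫ x, (∑ k, x k) ^ 2 ∂μ ≤ Fintype.card V * (m * b ^ 2) := by
  rw [H.integral_sq_sum_eq, ← nsmul_eq_mul, ← Finset.card_univ]
  refine Finset.sum_le_card_nsmul _ _ _ fun i _ => (Finset.sum_le_card_nsmul _ _ (b ^ 2)
    fun j _ => (le_abs_self _).trans (by simpa using H.abs_integral_prod_le [i, j])).trans ?_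
  rw [nsmul_eq_mul]
  gcongr
  simpa using H.card_listNbhd_le [i]

/-- Third order expansion of Stein's operator for sums of locally dependent variables. -/
theorem exists_stein_expansion (H : LocallyDependent μ A m b) :
    ∃ γ : ℝ, ∀ (g g1 g2 g3 M : ℝ → ℝ) (ρ : ℝ), (∀ w, HasDerivAt g (g1 w) w) →
      (∀ w, HasDerivAt g1 (g2 w) w) → (∀ w, HasDerivAt g2 (g3 w) w) → 3 * m * b ≤ ρ →
      (∀ w u, |u| ≤ ρ → |g3 (w + u)| ≤ M w) → Integrable (fun x => M (∑ k, x k)) μ →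
      |∫ x, (∑ k, x k) * g (∑ k, x k) ∂μ -
        (∫ x, (∑ k, x k) ^ 2 ∂μ) * ∫ x, g1 (∑ k, x k) ∂μ - γ * ∫ x, g2 (∑ k, x k) ∂μ| ≤
        28 * Fintype.card V * m ^ 3 * b ^ 4 * ∫ x, M (∑ k, x k) ∂μ := by
  have hb := H.nonneg
  -- The first part of `γ` comes from decoupling the pairs `x i * x j` from `g1`, the second from
  -- the quadratic Taylor term of `g`. The constant is `28 = 1 + 24 + 6 / 2`.
  refine ⟨∑ i, ((∑ j ∈ listNbhd A [i], ∫ x, x i * x j * ∑ k ∈ listNbhd A [i, j], x k ∂μ) -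
    (∑ j ∈ listNbhd A [i], ∫ x, x i * x j * (∑ k ∈ listNbhd A [i], x k) ∂μ) / 2), ?_⟩
  intro g g1 g2 g3 M ρ h h1 h2 hρ hM hMi
  have hg : Continuous g := continuous_iff_continuousAt.2 fun w => (h w).continuousAt
  have hg1 : Continuous g1 := continuous_iff_continuousAt.2 fun w => (h1 w).continuousAt
  have hg2 : Continuous g2 := continuous_iff_continuousAt.2 fun w => (h2 w).continuousAt
  have hmb : (0 : ℝ) ≤ m * b := by positivity
  have hM0 : ∀ w, 0 ≤ M w := fun w => (abs_nonneg _).trans (hM w 0 (by simp; nlinarith))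
  have hI : 0 ≤ ∫ x, M (∑ k, x k) ∂μ := integral_nonneg fun x => hM0 _
  have hsum : ∫ x, (∑ k, x k) * g (∑ k, x k) ∂μ = ∑ i, ∫ x, x i * g (∑ k, x k) ∂μ := by
    rw [← integral_finsetSum _ fun k _ => H.integrable (by fun_prop)]
    simp only [Finset.sum_mul]
  rw [hsum, H.integral_sq_sum_eq, Finset.sum_mul, Finset.sum_mul, ← Finset.sum_sub_distrib,
    ← Finset.sum_sub_distrib]
  refine (Finset.abs_sum_le_sum_abs _ _).trans ((Finset.sum_le_card_nsmul _ _
    (28 * m ^ 3 * b ^ 4 * ∫ x, M (∑ k, x k) ∂μ) fun i _ => ?_).trans (le_of_eq ?_))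
  swap
  · rw [nsmul_eq_mul, Finset.card_univ]; ring
  set I := ∫ x, M (∑ k, x k) ∂μ
  set N := listNbhd A [i] with hN
  have hcard : (N.card : ℝ) ≤ m := by simpa using H.card_listNbhd_le [i]
  set R : (V → ℝ) → ℝ := fun x => g (∑ k, x k) - g (∑ k, x k - ∑ k ∈ N, x k) -
    (∑ k ∈ N, x k) * g1 (∑ k, x k) + (∑ k ∈ N, x k) ^ 2 / 2 * g2 (∑ k, x k) with hR
  have hRc : Continuous R := by fun_prop
  have hRb : ∀ᵐ x ∂μ, |R x| ≤ (m * b) ^ 3 * M (∑ k, x k) := by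
    filter_upwards [H.abs_sum_le [i]] with x hx
    have hx : |∑ k ∈ N, x k| ≤ m * b := by simpa using hx
    refine (taylor_bound_three h h1 h2 fun u hu => hM _ u (hu.trans (hx.trans ?_))).trans ?_
    · linarith
    · have := hM0 (∑ k, x k)
      gcongr
  have e0 := H.decouple_identity [i] hg
  simp only [List.map_cons, List.map_nil, List.prod_cons, List.prod_nil, mul_one, H.mean,
    zero_mul, zero_add, sub_zero, ← hN] at e0
  have e1 : ∫ x, x i * (g (∑ k, x k) - g (∑ k, x k - ∑ k ∈ N, x k)) ∂μ =
      ∑ j ∈ N, ∫ x, x i * x j * g1 (∑ k, x k) ∂μ -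
      (∑ j ∈ N, ∫ x, x i * x j * (∑ k ∈ N, x k) * g2 (∑ k, x k) ∂μ) / 2 +
      ∫ x, x i * R x ∂μ := by
    rw [← integral_finsetSum _ fun k _ => H.integrable (by fun_prop),
      ← integral_finsetSum _ fun k _ => H.integrable (by fun_prop), ← integral_div,
      ← integral_sub (H.integrable (by fun_prop)) (H.integrable (by fun_prop)),
      ← integral_add (H.integrable (by fun_prop)) (H.integrable (by fun_prop))]
    congr 1; ext x
    simp only [hR, ← Finset.sum_mul, ← Finset.mul_sum]; ring
  have b1 : |∫ x, x i * R x ∂μ| ≤ b * (m * b) ^ 3 * I :=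
    abs_integral_le_of_bound hMi (by
      filter_upwards [hRb, H.bound i] with x hx hp
      rw [abs_mul, mul_assoc]; gcongr)
  have b2 : |∑ j ∈ N, (∫ x, x i * x j * g1 (∑ k, x k) ∂μ -
      (∫ x, x i * x j ∂μ) * ∫ x, g1 (∑ k, x k) ∂μ -
      (∫ x, x i * x j * ∑ k ∈ listNbhd A [i, j], x k ∂μ) * ∫ x, g2 (∑ k, x k) ∂μ)| ≤
      m * (24 * m ^ 2 * b ^ 4 * I) := by
    refine (Finset.abs_sum_le_sum_abs _ _).trans ((Finset.sum_le_card_nsmul _ _ _ fun j _ =>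
      H.abs_integral_pair_sub_le i j h1 h2 hρ hM hMi).trans ?_)
    rw [nsmul_eq_mul]; gcongr
  have b3 : |∑ j ∈ N, (∫ x, x i * x j * (∑ k ∈ N, x k) * g2 (∑ k, x k) ∂μ -
      (∫ x, x i * x j * (∑ k ∈ N, x k) ∂μ) * ∫ x, g2 (∑ k, x k) ∂μ)| ≤
      m * (m * (6 * m * b ^ 4 * I)) := by
    refine (Finset.abs_sum_le_sum_abs _ _).trans ((Finset.sum_le_card_nsmul _ _
      (m * (6 * m * b ^ 4 * I)) fun j _ => ?_).trans ?_)
    · have := H.abs_integral_prod_mul_sum_sub_le [i, j] N h2 (ρ := ρ)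
        (by simpa using le_trans (le_of_eq (by norm_num)) hρ) hM hMi
      simp only [List.map_cons, List.map_nil, List.prod_cons, List.prod_nil, mul_one,
        List.length_cons, List.length_nil] at this
      refine this.trans ?_
      calc _ ≤ m * (2 * (b ^ (0 + 1 + 1 + 1) * ((0 + 1 + 1 + 1 : ℕ) * m * b)) * I) := by gcongr
        _ = _ := by push_cast; ring
    · rw [nsmul_eq_mul]; gcongr
  rw [e0, e1]
  simp only [Finset.sum_sub_distrib, ← Finset.sum_mul] at b2 b3
  rw [abs_le] at *
  constructor <;> nlinarith

end LocallyDependent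
end LocalDependence

/-! ### Exponential tilting and the size of the third order coefficient. -/

section SteinExpansion

set_option linter.unusedSectionVars false

/-- `ν` is a centred measure of bounded support with a third order expansion of Stein's operator. -/
structure SteinExpansion (ν : Measure ℝ) (γ ε ρ : ℝ) : Prop where
  bdd : ∃ R, ∀ᵐ w ∂ν, |w| ≤ R
  mean : ∫ w, w ∂ν = 0
  pos : 0 < ε
  nonneg : 0 ≤ ρ
  le : ρ ≤ ε
  expansion : ∀ g g1 g2 g3 M : ℝ → ℝ, (∀ w, HasDerivAt g (g1 w) w) →
      (∀ w, HasDerivAt g1 (g2 w) w) → (∀ w, HasDerivAt g2 (g3 w) w) →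
      (∀ w u, |u| ≤ ρ → |g3 (w + u)| ≤ M w) → Integrable M ν →
      |∫ w, w * g w ∂ν - ∫ w, g1 w ∂ν - γ * ∫ w, g2 w ∂ν| ≤ ε ^ 2 * ∫ w, M w ∂ν

theorem integrable_of_continuous_of_ae_abs_le {ν : Measure ℝ} [IsFiniteMeasure ν]
    (h : ∃ R, ∀ᵐ w ∂ν, |w| ≤ R) {F : ℝ → ℝ} (hF : Continuous F) : Integrable F ν := by
  obtain ⟨R, hR⟩ := h
  obtain ⟨C, hC⟩ := (isCompact_Icc (a := -R) (b := R)).exists_bound_of_continuousOn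
    hF.continuousOn
  refine Integrable.of_bound hF.measurable.aestronglyMeasurable C ?_
  filter_upwards [hR] with x hx
  exact hC x (abs_le.1 hx)

/-- The law of `W - a` under the exponential tilt of the law `ν` of `W` by `a`. -/
noncomputable def centredTilt (ν : Measure ℝ) (a : ℝ) : Measure ℝ :=
  (ν.tilted fun w => a * w).map (· - a)

theorem measurableEmbedding_sub_const (a : ℝ) : MeasurableEmbedding fun w : ℝ => w - a :=
  (MeasurableEquiv.subRight a).measurableEmbedding

theorem integral_centredTilt (ν : Measure ℝ) (a : ℝ) (F : ℝ → ℝ) :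
    ∫ y, F y ∂(centredTilt ν a) =
      (∫ w, Real.exp (a * w) * F (w - a) ∂ν) / ∫ w, Real.exp (a * w) ∂ν := by
  rw [centredTilt, (measurableEmbedding_sub_const a).integral_map, integral_tilted, ← integral_div]
  congr 1; ext w
  simp only [smul_eq_mul]; ring

theorem integrable_centredTilt_iff {ν : Measure ℝ} {a : ℝ} {F : ℝ → ℝ}
    (h : Integrable (fun w => Real.exp (a * w)) ν) :
    Integrable F (centredTilt ν a) ↔ Integrable (fun w => Real.exp (a * w) * F (w - a)) ν := by
  rw [centredTilt, (measurableEmbedding_sub_const a).integrable_map_iff, integrable_tilted_iff h]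
  rfl

namespace SteinExpansion

variable {ν : Measure ℝ} [IsProbabilityMeasure ν] {γ ε ρ : ℝ}

theorem integrable (H : SteinExpansion ν γ ε ρ) {F : ℝ → ℝ} (hF : Continuous F) :
    Integrable F ν := integrable_of_continuous_of_ae_abs_le H.bdd hF

theorem integrable_exp (H : SteinExpansion ν γ ε ρ) (a : ℝ) :
    Integrable (fun w => Real.exp (a * w)) ν := H.integrable (by fun_prop)

theorem mgf_pos (H : SteinExpansion ν γ ε ρ) (a : ℝ) : 0 < ∫ w, Real.exp (a * w) ∂ν :=
  integral_exp_pos (H.integrable_exp a)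

theorem isProbabilityMeasure_centredTilt (H : SteinExpansion ν γ ε ρ) (a : ℝ) :
    IsProbabilityMeasure (centredTilt ν a) := by
  have := isProbabilityMeasure_tilted (H.integrable_exp a)
  exact Measure.isProbabilityMeasure_map (measurableEmbedding_sub_const a).measurable.aemeasurable

theorem bdd_centredTilt (H : SteinExpansion ν γ ε ρ) (a : ℝ) :
    ∃ R, ∀ᵐ y ∂(centredTilt ν a), |y| ≤ R := by
  obtain ⟨R, hR⟩ := H.bdd
  refine ⟨R + |a|, ?_⟩
  rw [centredTilt, (measurableEmbedding_sub_const a).ae_map_iff]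
  filter_upwards [tilted_absolutelyContinuous ν _ hR] with w hw
  exact (abs_sub _ _).trans (by linarith)

theorem exp_mul_le_three {x : ℝ} (hx : x ≤ 1) : Real.exp x ≤ 3 :=
  (Real.exp_le_exp.2 hx).trans (by have := Real.exp_one_lt_d9; linarith)

/-- Stein's identity for the centred exponential tilts. -/
theorem abs_integral_centredTilt_le (H : SteinExpansion ν γ ε ρ) {a : ℝ} (ha : 0 ≤ a)
    (haρ : a * ρ ≤ 1) {f f1 f2 f3 M : ℝ → ℝ} (h : ∀ w, HasDerivAt f (f1 w) w)
    (h1 : ∀ w, HasDerivAt f1 (f2 w) w) (h2 : ∀ w, HasDerivAt f2 (f3 w) w)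
    (hM : ∀ y u, |u| ≤ ρ → |a ^ 3 * f (y + u) + 3 * a ^ 2 * f1 (y + u) + 3 * a * f2 (y + u) +
      f3 (y + u)| ≤ M y) (hMi : Integrable M (centredTilt ν a)) :
    |∫ y, (y * f y - f1 y) ∂(centredTilt ν a)| ≤
      |γ| * |∫ y, (a ^ 2 * f y + 2 * a * f1 y + f2 y) ∂(centredTilt ν a)| +
      3 * ε ^ 2 * ∫ y, M y ∂(centredTilt ν a) := by
  have hφ := H.mgf_pos a
  have hf : Continuous f := continuous_iff_continuousAt.2 fun w => (h w).continuousAt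
  have hf1 : Continuous f1 := continuous_iff_continuousAt.2 fun w => (h1 w).continuousAt
  have hf2 : Continuous f2 := continuous_iff_continuousAt.2 fun w => (h2 w).continuousAt
  have hE : ∀ w, HasDerivAt (fun w => Real.exp (a * w)) (a * Real.exp (a * w)) w := fun w =>
    (((hasDerivAt_id' w).const_mul a).exp).congr_deriv (by ring)
  have hS : ∀ {F F' : ℝ → ℝ}, (∀ w, HasDerivAt F (F' w) w) → ∀ w,
      HasDerivAt (fun w => F (w - a)) (F' (w - a)) w := fun hF w =>
    (hF (w - a)).comp_sub_const w a
  rw [integrable_centredTilt_iff (H.integrable_exp a)] at hMi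
  -- Differentiating the exponential produces `a * f`, which turns the factor `w` of Stein's
  -- operator into `w - a`. The factor `3` bounds `exp (a * u)` for `|u| ≤ ρ`.
  have key := H.expansion (fun w => Real.exp (a * w) * f (w - a))
    (fun w => Real.exp (a * w) * (a * f (w - a) + f1 (w - a)))
    (fun w => Real.exp (a * w) * (a ^ 2 * f (w - a) + 2 * a * f1 (w - a) + f2 (w - a)))
    (fun w => Real.exp (a * w) * (a ^ 3 * f (w - a) + 3 * a ^ 2 * f1 (w - a) +
      3 * a * f2 (w - a) + f3 (w - a)))
    (fun w => 3 * (Real.exp (a * w) * M (w - a)))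
    (fun w => ((hE w).fun_mul (hS h w)).congr_deriv (by ring))
    (fun w => ((hE w).fun_mul (((hS h w).const_mul a).fun_add (hS h1 w))).congr_deriv (by ring))
    (fun w => ((hE w).fun_mul ((((hS h w).const_mul (a ^ 2)).fun_add
      ((hS h1 w).const_mul (2 * a))).fun_add (hS h2 w))).congr_deriv (by ring))
    (fun w u hu => by
      have h0 := hM (w - a) u hu
      rw [show w - a + u = w + u - a by ring] at h0
      rw [abs_mul, Real.abs_exp, mul_add, Real.exp_add]
      have h3 : Real.exp (a * u) ≤ 3 := exp_mul_le_three
        (le_trans (by gcongr; exact (le_abs_self u).trans hu) haρ)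
      have hM0 : 0 ≤ M (w - a) := (abs_nonneg _).trans h0
      calc _ ≤ Real.exp (a * w) * 3 * M (w - a) := by gcongr
        _ = _ := by ring)
    (hMi.const_mul 3)
  simp only [integral_centredTilt]
  rw [integral_const_mul] at key
  have e : ∫ w, Real.exp (a * w) * ((w - a) * f (w - a) - f1 (w - a)) ∂ν =
      ∫ w, w * (Real.exp (a * w) * f (w - a)) ∂ν -
        ∫ w, Real.exp (a * w) * (a * f (w - a) + f1 (w - a)) ∂ν := by
    rw [← integral_sub (H.integrable (by fun_prop)) (H.integrable (by fun_prop))]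
    congr 1; ext w; ring
  rw [abs_div, abs_div, abs_of_pos hφ, e, mul_div_assoc', mul_div_assoc', ← add_div]
  gcongr
  rw [← abs_mul]
  have := abs_sub_abs_le_abs_sub (∫ w, w * (Real.exp (a * w) * f (w - a)) ∂ν -
        ∫ w, Real.exp (a * w) * (a * f (w - a) + f1 (w - a)) ∂ν)
        (γ * ∫ w, Real.exp (a * w) * (a ^ 2 * f (w - a) + 2 * a * f1 (w - a) + f2 (w - a)) ∂ν)
  linarith

/-- The derivative of the moment generating function. -/
theorem abs_mgf_deriv_sub_le (H : SteinExpansion ν γ ε ρ) {a : ℝ} (haρ : |a| * ρ ≤ 1) :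
    |∫ w, w * Real.exp (a * w) ∂ν - a * ∫ w, Real.exp (a * w) ∂ν -
      γ * (a ^ 2 * ∫ w, Real.exp (a * w) ∂ν)| ≤
      ε ^ 2 * (3 * |a| ^ 3 * ∫ w, Real.exp (a * w) ∂ν) := by
  have hE : ∀ w, HasDerivAt (fun w => Real.exp (a * w)) (a * Real.exp (a * w)) w := fun w =>
    (((hasDerivAt_id' w).const_mul a).exp).congr_deriv (by ring)
  have key := H.expansion (fun w => Real.exp (a * w)) (fun w => a * Real.exp (a * w))
    (fun w => a ^ 2 * Real.exp (a * w)) (fun w => a ^ 3 * Real.exp (a * w))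
    (fun w => 3 * |a| ^ 3 * Real.exp (a * w)) hE
    (fun w => ((hE w).const_mul a).congr_deriv (by ring))
    (fun w => ((hE w).const_mul (a ^ 2)).congr_deriv (by ring))
    (fun w u hu => by
      rw [abs_mul, Real.abs_exp, mul_add, Real.exp_add, abs_pow]
      have h3 : Real.exp (a * u) ≤ 3 := exp_mul_le_three
        ((le_abs_self _).trans (by rw [abs_mul]; exact le_trans (by gcongr) haρ))
      calc _ ≤ |a| ^ 3 * (Real.exp (a * w) * 3) := by gcongr
        _ = _ := by ring)
    ((H.integrable_exp a).const_mul _)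
  simpa only [integral_const_mul] using key

/-- By centring, the quantity is the mean of `x * (exp x - 1)` at `x = a * w`, which is pointwise
nonnegative. -/
theorem mul_mgf_deriv_nonneg (H : SteinExpansion ν γ ε ρ) (a : ℝ) :
    0 ≤ a * ∫ w, w * Real.exp (a * w) ∂ν := by
  have e : a * ∫ w, w * Real.exp (a * w) ∂ν = ∫ w, (a * w) * (Real.exp (a * w) - 1) ∂ν := by
    have : ∫ w, (a * w) * (Real.exp (a * w) - 1) ∂ν =
        ∫ w, a * (w * Real.exp (a * w)) ∂ν - ∫ w, a * w ∂ν := by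
      rw [← integral_sub (H.integrable (by fun_prop)) (H.integrable (by fun_prop))]
      congr 1; ext w; ring
    rw [this, integral_const_mul, integral_const_mul, H.mean]; ring
  rw [e]
  refine integral_nonneg fun w => ?_
  rcases le_total 0 (a * w) with h | h
  · exact mul_nonneg h (by simpa using h)
  · exact mul_nonneg_of_nonpos_of_nonpos h (by simpa using h)

/-- The third order coefficient is of the order of `ε`: otherwise the moment generating function
would not be increasing in the distance from the origin. -/
theorem abs_coeff_le (H : SteinExpansion ν γ ε ρ) : |γ| ≤ 4 * ε := by
  have hε := H.pos
  -- At this scale the remainder `3 ε² a⁴ φ` equals `3 a² φ`, comparable with the main term `a² φ`,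
  -- so `0 ≤ a φ'(a) ≤ (4 + γ a) a² φ`. Both signs of `a` together bound `|γ|`.
  have main : ∀ a : ℝ, |a| = 1 / ε → 0 ≤ 4 + γ * a := by
    intro a ha
    have hφ := H.mgf_pos a
    have h1 := H.abs_mgf_deriv_sub_le (a := a) (by
      rw [ha, one_div, inv_mul_le_one₀ hε]; exact H.le)
    have h2 := H.mul_mgf_deriv_nonneg a
    set φ := ∫ w, Real.exp (a * w) ∂ν
    set I := ∫ w, w * Real.exp (a * w) ∂ν
    have ha2 : a ^ 2 * ε ^ 2 = 1 := by rw [← sq_abs, ha]; field_simp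
    have h3 : a * I - a ^ 2 * φ - γ * a ^ 3 * φ ≤ 3 * a ^ 2 * φ := by
      calc a * I - a ^ 2 * φ - γ * a ^ 3 * φ = a * (I - a * φ - γ * (a ^ 2 * φ)) := by ring
        _ ≤ |a| * |I - a * φ - γ * (a ^ 2 * φ)| := by rw [← abs_mul]; exact le_abs_self _
        _ ≤ |a| * (ε ^ 2 * (3 * |a| ^ 3 * φ)) := by gcongr
        _ = 3 * (a ^ 2 * ε ^ 2) * a ^ 2 * φ := by
          rw [show |a| * (ε ^ 2 * (3 * |a| ^ 3 * φ)) = 3 * ((|a| ^ 2) * ε ^ 2) * |a| ^ 2 * φ by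
            ring, sq_abs]
        _ = _ := by rw [ha2]; ring
    have h4 : 0 ≤ (4 + γ * a) * (a ^ 2 * φ) := by nlinarith
    have h5 : 0 < a ^ 2 * φ := by
      have : 0 < a ^ 2 := by
        by_contra hc
        have : a ^ 2 = 0 := le_antisymm (not_lt.1 hc) (sq_nonneg a)
        rw [this] at ha2; simp at ha2
      positivity
    exact nonneg_of_mul_nonneg_left h4 h5
  have h1 := main (1 / ε) (abs_of_pos (by positivity))
  have h2 := main (-(1 / ε)) (by rw [abs_neg]; exact abs_of_pos (by positivity))
  have e : γ * (1 / ε) * ε = γ := by field_simp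
  rw [abs_le]
  constructor <;> nlinarith

end SteinExpansion
end SteinExpansion

/-! ### Solution of Stein's equation and a smooth step. -/

section SteinSolution

theorem integrable_exp_neg_sq_div_two : Integrable fun u : ℝ => Real.exp (-u ^ 2 / 2) := by
  have := integrable_exp_neg_mul_sq (b := 1 / 2) (by norm_num)
  refine this.congr (ae_of_all _ fun u => ?_)
  simp only; congr 1; ring

/-- On `u > w` the factor `w` may be replaced by `u`, which makes the integrand an exact derivative.
-/
theorem mul_integral_Ioi_exp_neg_sq_le {w : ℝ} :
    w * ∫ u in Set.Ioi w, Real.exp (-u ^ 2 / 2) ≤ Real.exp (-w ^ 2 / 2) := by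
  have hi : Integrable fun u : ℝ => u * Real.exp (-u ^ 2 / 2) := by
    have := integrable_mul_exp_neg_mul_sq (b := 1 / 2) (by norm_num)
    refine this.congr (ae_of_all _ fun u => ?_)
    simp only; congr 2; ring
  have e : ∫ u in Set.Ioi w, u * Real.exp (-u ^ 2 / 2) = Real.exp (-w ^ 2 / 2) := by
    have hd : ∀ x : ℝ, HasDerivAt (fun u : ℝ => -Real.exp (-u ^ 2 / 2))
        (x * Real.exp (-x ^ 2 / 2)) x := fun x =>
      ((((hasDerivAt_id' x).fun_pow 2).fun_neg.div_const 2).exp.fun_neg).congr_deriv (by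
        simp; ring)
    have ht : Filter.Tendsto (fun u : ℝ => -Real.exp (-u ^ 2 / 2)) Filter.atTop (nhds (-0)) := by
      refine (Real.tendsto_exp_atBot.comp ?_).neg
      have : Filter.Tendsto (fun u : ℝ => u ^ 2 / 2) Filter.atTop Filter.atTop :=
        (Filter.tendsto_pow_atTop two_ne_zero).atTop_div_const two_pos
      refine (Filter.tendsto_neg_atTop_atBot.comp this).congr fun u => ?_
      simp [neg_div]
    rw [integral_Ioi_of_hasDerivAt_of_tendsto (hd w).continuousAt.continuousWithinAt
      (fun x _ => hd x) hi.integrableOn ht]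
    simp
  rw [← integral_const_mul, ← e]
  refine setIntegral_mono_on (integrable_exp_neg_sq_div_two.const_mul w).integrableOn
    hi.integrableOn measurableSet_Ioi fun u hu => ?_
  have : w ≤ u := le_of_lt hu
  gcongr

theorem integral_Ioi_exp_neg_sq_le (w : ℝ) :
    ∫ u in Set.Ioi w, Real.exp (-u ^ 2 / 2) ≤ 3 := by
  have h1 : ∫ u in Set.Ioi w, Real.exp (-u ^ 2 / 2) ≤ ∫ u, Real.exp (-u ^ 2 / 2) :=
    setIntegral_le_integral integrable_exp_neg_sq_div_two
      (ae_of_all _ fun u => (Real.exp_pos _).le)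
  have h2 : ∫ u : ℝ, Real.exp (-u ^ 2 / 2) = √(2 * Real.pi) := by
    have := integral_gaussian (1 / 2)
    rw [show Real.pi / (1 / 2) = 2 * Real.pi by ring] at this
    rw [← this]
    congr 1; ext u; congr 1; ring
  have h3 : √(2 * Real.pi) ≤ 3 := by
    rw [Real.sqrt_le_left (by norm_num)]
    have := Real.pi_lt_d2
    linarith
  linarith

/-- The bounds on Mills' ratio used for the solution of Stein's equation. -/
theorem mills_upper {w : ℝ} (hw : 0 ≤ w) :
    Real.exp (w ^ 2 / 2) * ∫ u in Set.Ioi w, Real.exp (-u ^ 2 / 2) ≤ 6 ∧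
      w * (Real.exp (w ^ 2 / 2) * ∫ u in Set.Ioi w, Real.exp (-u ^ 2 / 2)) ≤ 6 := by
  have h1 := integral_Ioi_exp_neg_sq_le w
  have h2 := mul_integral_Ioi_exp_neg_sq_le (w := w)
  have h0 : 0 ≤ ∫ u in Set.Ioi w, Real.exp (-u ^ 2 / 2) :=
    integral_nonneg fun u => (Real.exp_pos _).le
  set T := ∫ u in Set.Ioi w, Real.exp (-u ^ 2 / 2)
  have h3 : w * (Real.exp (w ^ 2 / 2) * T) ≤ 1 := by
    calc _ = Real.exp (w ^ 2 / 2) * (w * T) := by ring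
      _ ≤ Real.exp (w ^ 2 / 2) * Real.exp (-w ^ 2 / 2) := by gcongr
      _ = 1 := by rw [← Real.exp_add]; simp [neg_div]
  refine ⟨?_, h3.trans (by norm_num)⟩
  rcases le_total w 1 with h | h
  · have : Real.exp (w ^ 2 / 2) ≤ 2 := by
      have h5 : Real.exp (w ^ 2 / 2) ≤ Real.exp (1 / 2) := Real.exp_le_exp.2 (by nlinarith)
      have h6 : Real.exp (1 / 2) ^ 2 = Real.exp 1 := by rw [← Real.exp_nat_mul]; norm_num
      have := Real.exp_one_lt_d9
      have := Real.exp_pos (1 / 2)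
      nlinarith
    calc _ ≤ 2 * (3 : ℝ) := by gcongr
      _ = 6 := by norm_num
  · have : 0 ≤ Real.exp (w ^ 2 / 2) * T := by positivity
    nlinarith

theorem integral_Iic_exp_neg_sq (w : ℝ) :
    ∫ u in Set.Iic w, Real.exp (-u ^ 2 / 2) = ∫ u in Set.Ioi (-w), Real.exp (-u ^ 2 / 2) := by
  rw [← integral_comp_neg_Iic]
  simp

theorem integral_gaussianReal_std (h : ℝ → ℝ) :
    ∫ u, h u ∂(gaussianReal 0 1) = (√(2 * Real.pi))⁻¹ * ∫ u, h u * Real.exp (-u ^ 2 / 2) := by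
  rw [integral_gaussianReal_eq_integral_smul one_ne_zero, ← integral_const_mul]
  congr 1; ext u
  simp [gaussianPDFReal_def]; ring

/-- Stein's equation for a continuous function with values in `[0, 1]`. -/
theorem exists_stein_solution {h : ℝ → ℝ} (hc : Continuous h) (h0 : ∀ w, 0 ≤ h w)
    (h1 : ∀ w, h w ≤ 1) :
    ∃ f : ℝ → ℝ, (∀ w, HasDerivAt f (w * f w + h w - ∫ u, h u ∂(gaussianReal 0 1)) w) ∧
      (∀ w, |f w| ≤ 6) ∧ ∀ w, |w * f w| ≤ 6 := by
  have hi : Integrable h (gaussianReal 0 1) := Integrable.of_bound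
    hc.measurable.aestronglyMeasurable 1 (ae_of_all _ fun u => by
      rw [Real.norm_eq_abs, abs_of_nonneg (h0 u)]; exact h1 u)
  set c := ∫ u, h u ∂(gaussianReal 0 1) with hcdef
  have hc0 : 0 ≤ c := integral_nonneg h0
  have hc1 : c ≤ 1 := by
    have := integral_mono hi (integrable_const (1 : ℝ)) h1
    simpa using this
  set k : ℝ → ℝ := fun u => (h u - c) * Real.exp (-u ^ 2 / 2) with hk
  have hkb : ∀ u, ‖k u‖ ≤ Real.exp (-u ^ 2 / 2) := fun u => by
    rw [hk, norm_mul, Real.norm_eq_abs, Real.norm_eq_abs, Real.abs_exp]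
    refine mul_le_of_le_one_left (Real.exp_pos _).le ?_
    rw [abs_le]; constructor <;> linarith [h0 u, h1 u]
  have hkc : Continuous k := by fun_prop
  have hki : Integrable k := integrable_exp_neg_sq_div_two.mono'
    hkc.measurable.aestronglyMeasurable (ae_of_all _ hkb)
  have hki0 : ∫ u, k u = 0 := by
    have e := integral_gaussianReal_std fun u => h u - c
    rw [integral_sub hi (integrable_const c)] at e
    have h2 : (√(2 * Real.pi))⁻¹ ≠ 0 := by positivity
    have h3 : ∫ u, h u ∂(gaussianReal 0 1) - ∫ _, c ∂(gaussianReal 0 1) = 0 := by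
      simp [← hcdef]
    rw [h3] at e
    exact (mul_eq_zero.1 e.symm).resolve_left h2
  have hF : ∀ w, HasDerivAt (fun w => ∫ u in Set.Iic w, k u) (k w) w := by
    intro w
    have e : (fun w => ∫ u in Set.Iic w, k u) =
        fun w => (∫ u in Set.Iic 0, k u) + ∫ u in (0 : ℝ)..w, k u := by
      ext w
      rw [← intervalIntegral.integral_Iic_sub_Iic hki.integrableOn hki.integrableOn]
      ring
    rw [e]
    exact (intervalIntegral.integral_hasDerivAt_right (hkc.intervalIntegrable _ _)
      (hkc.stronglyMeasurableAtFilter _ _) hkc.continuousAt).const_add _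
  have hL : ∀ w, |∫ u in Set.Iic w, k u| ≤ ∫ u in Set.Ioi (-w), Real.exp (-u ^ 2 / 2) := by
    intro w
    rw [← integral_Iic_exp_neg_sq]
    exact norm_integral_le_of_norm_le integrable_exp_neg_sq_div_two.integrableOn
      (ae_of_all _ hkb)
  -- As `k` has total integral zero, the left integral can be traded for the right one; each sign of
  -- `w` uses the smaller Gaussian tail.
  have hR : ∀ w, |∫ u in Set.Iic w, k u| ≤ ∫ u in Set.Ioi w, Real.exp (-u ^ 2 / 2) := by
    intro w
    have e := intervalIntegral.integral_Iic_add_Ioi (b := w) hki.integrableOn hki.integrableOn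
    rw [hki0] at e
    rw [eq_neg_of_add_eq_zero_left e, abs_neg]
    exact norm_integral_le_of_norm_le integrable_exp_neg_sq_div_two.integrableOn
      (ae_of_all _ hkb)
  have hB : ∀ w, |Real.exp (w ^ 2 / 2) * ∫ u in Set.Iic w, k u| ≤ 6 ∧
      |w * (Real.exp (w ^ 2 / 2) * ∫ u in Set.Iic w, k u)| ≤ 6 := by
    intro w
    have key : ∀ v : ℝ, 0 ≤ v → |w| = v → w ^ 2 = v ^ 2 →
        |∫ u in Set.Iic w, k u| ≤ ∫ u in Set.Ioi v, Real.exp (-u ^ 2 / 2) →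
        |Real.exp (w ^ 2 / 2) * ∫ u in Set.Iic w, k u| ≤ 6 ∧
        |w * (Real.exp (w ^ 2 / 2) * ∫ u in Set.Iic w, k u)| ≤ 6 := by
      intro v hv h1 h2 h3
      obtain ⟨m1, m2⟩ := mills_upper hv
      rw [abs_mul w, abs_mul, Real.abs_exp, h1, h2]
      exact ⟨le_trans (by gcongr) m1, le_trans (by gcongr) m2⟩
    rcases le_total 0 w with hw | hw
    · exact key w hw (abs_of_nonneg hw) rfl (hR w)
    · exact key (-w) (by linarith) (abs_of_nonpos hw) (by ring) (hL w)
  refine ⟨fun w => Real.exp (w ^ 2 / 2) * ∫ u in Set.Iic w, k u, fun w => ?_,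
    fun w => (hB w).1, fun w => (hB w).2⟩
  have hE : HasDerivAt (fun w : ℝ => Real.exp (w ^ 2 / 2)) (w * Real.exp (w ^ 2 / 2)) w :=
    ((((hasDerivAt_id' w).fun_pow 2).div_const 2).exp).congr_deriv (by simp; ring)
  refine (hE.fun_mul (hF w)).congr_deriv ?_
  have : Real.exp (w ^ 2 / 2) * Real.exp (-w ^ 2 / 2) = 1 := by
    rw [← Real.exp_add]; simp [neg_div]
  simp only [hk]
  linear_combination (h w - c) * this

/-- A smooth nonincreasing function equal to `1` on the negative and to `0` beyond `1`. -/
theorem exists_smooth_step : ∃ (c : ℝ) (ψ ψ1 ψ2 : ℝ → ℝ), 1 ≤ c ∧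
    (∀ u, HasDerivAt ψ (ψ1 u) u) ∧ (∀ u, HasDerivAt ψ1 (ψ2 u) u) ∧
    (∀ u, 0 ≤ ψ u) ∧ (∀ u, ψ u ≤ 1) ∧ (∀ u ≤ 0, ψ u = 1) ∧ (∀ u, 1 ≤ u → ψ u = 0) ∧
    (∀ u, |ψ1 u| ≤ c) ∧ (∀ u, |ψ2 u| ≤ c) ∧
    (∀ u ∉ Set.Icc (0 : ℝ) 1, ψ1 u = 0) ∧ ∀ u ∉ Set.Icc (0 : ℝ) 1, ψ2 u = 0 := by
  set ψ : ℝ → ℝ := fun u => 1 - Real.smoothTransition u with hψ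
  have hs : ContDiff ℝ 2 ψ := contDiff_const.sub Real.smoothTransition.contDiff
  have hs1 : ContDiff ℝ 1 (deriv ψ) := ((contDiff_succ_iff_deriv (n := 1)).1 hs).2.2
  have hs2 : Continuous (deriv (deriv ψ)) := hs1.continuous_deriv le_rfl
  have hc1 : ∀ u < 0, ψ =ᶠ[nhds u] fun _ => 1 := fun u hu => by
    filter_upwards [gt_mem_nhds hu] with v hv
    simp [hψ, Real.smoothTransition.zero_of_nonpos hv.le]
  have hc2 : ∀ u, 1 < u → ψ =ᶠ[nhds u] fun _ => 0 := fun u hu => by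
    filter_upwards [lt_mem_nhds hu] with v hv
    simp [hψ, Real.smoothTransition.one_of_one_le hv.le]
  have hd1 : ∀ u ∉ Set.Icc (0 : ℝ) 1, deriv ψ =ᶠ[nhds u] fun _ => 0 := fun u hu => by
    rw [Set.mem_Icc, not_and_or, not_le, not_le] at hu
    rcases hu with hu | hu
    · simpa using (hc1 u hu).deriv
    · simpa using (hc2 u hu).deriv
  have hd2 : ∀ u ∉ Set.Icc (0 : ℝ) 1, deriv (deriv ψ) u = 0 := fun u hu => by
    simpa using (hd1 u hu).deriv.eq_of_nhds
  obtain ⟨C1, hC1⟩ := (isCompact_Icc (a := (0 : ℝ)) (b := 1)).exists_bound_of_continuousOn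
    hs1.continuous.continuousOn
  obtain ⟨C2, hC2⟩ := (isCompact_Icc (a := (0 : ℝ)) (b := 1)).exists_bound_of_continuousOn
    hs2.continuousOn
  refine ⟨max 1 (max C1 C2), ψ, deriv ψ, deriv (deriv ψ), le_max_left _ _,
    fun u => (hs.differentiable (by norm_num) u).hasDerivAt,
    fun u => (hs1.differentiable (by norm_num) u).hasDerivAt,
    fun u => by simp [hψ, Real.smoothTransition.le_one],
    fun u => by simp [hψ, Real.smoothTransition.nonneg],
    fun u hu => by simp [hψ, Real.smoothTransition.zero_of_nonpos hu],
    fun u hu => by simp [hψ, Real.smoothTransition.one_of_one_le hu], fun u => ?_, fun u => ?_,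
    fun u hu => (hd1 u hu).eq_of_nhds, hd2⟩
  · by_cases hu : u ∈ Set.Icc (0 : ℝ) 1
    · exact (hC1 u hu).trans (by simp)
    · rw [(hd1 u hu).eq_of_nhds]; simp
  · by_cases hu : u ∈ Set.Icc (0 : ℝ) 1
    · exact (hC2 u hu).trans (by simp)
    · rw [hd2 u hu]; simp

end SteinSolution

/-! ### Smoothing for the Kolmogorov distance. -/

section Kolmogorov

theorem gaussianReal_Iic_sub_le {u v : ℝ} (huv : u ≤ v) :
    (gaussianReal 0 1).real (Set.Iic v) - (gaussianReal 0 1).real (Set.Iic u) ≤ v - u := by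
  have h1 : (gaussianReal 0 1).real (Set.Iic v) - (gaussianReal 0 1).real (Set.Iic u) =
      (gaussianReal 0 1).real (Set.Ioc u v) := by
    rw [← Set.Iic_sdiff_Iic, measureReal_sdiff (Set.Iic_subset_Iic.2 huv) measurableSet_Iic]
  have h2 : gaussianReal 0 1 (Set.Ioc u v) ≤ volume (Set.Ioc u v) := by
    rw [gaussianReal_apply _ one_ne_zero]
    refine (setLIntegral_mono (g := fun _ => 1) measurable_const fun x _ => ?_).trans (by simp)
    rw [gaussianPDF, ENNReal.ofReal_le_one, gaussianPDFReal_def]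
    have hpi := Real.pi_gt_three
    have : 1 ≤ √(2 * Real.pi * (1 : NNReal)) := by
      rw [Real.one_le_sqrt]; simp; linarith
    refine mul_le_one₀ (inv_le_one_of_one_le₀ this) (Real.exp_pos _).le ?_
    rw [Real.exp_le_one_iff]
    simp only [NNReal.coe_one, mul_one, sub_zero]
    have := sq_nonneg x
    linarith
  rw [h1, measureReal_def]
  calc _ ≤ (volume (Set.Ioc u v)).toReal := ENNReal.toReal_mono (by simp) h2
    _ = v - u := by simp [huv]

variable {ν : Measure ℝ} [IsProbabilityMeasure ν] {η : ℝ}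

/-- This feeds the Kolmogorov distance back as a concentration estimate, using that the Gaussian
density is at most `1`. The slack `δ` accounts for a possible atom at `u`. -/
theorem measureReal_Icc_le
    (h : ∀ x, |ν.real (Set.Iic x) - (gaussianReal 0 1).real (Set.Iic x)| ≤ η) {u v : ℝ}
    (huv : u ≤ v) : ν.real (Set.Icc u v) ≤ v - u + 2 * η := by
  refine le_of_forall_pos_le_add fun δ hδ => ?_
  have h1 : ν.real (Set.Icc u v) ≤ ν.real (Set.Ioc (u - δ) v) :=
    measureReal_mono fun y hy => ⟨by linarith [hy.1], hy.2⟩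
  have h2 : ν.real (Set.Ioc (u - δ) v) = ν.real (Set.Iic v) - ν.real (Set.Iic (u - δ)) := by
    rw [← Set.Iic_sdiff_Iic,
      measureReal_sdiff (Set.Iic_subset_Iic.2 (by linarith)) measurableSet_Iic]
  have h3 := gaussianReal_Iic_sub_le (u := u - δ) (v := v) (by linarith)
  have h4 := abs_le.1 (h v)
  have h5 := abs_le.1 (h (u - δ))
  linarith

/-- The distribution functions are compared by means of smooth steps. -/
theorem abs_measureReal_Iic_sub_le_of_smooth {ψ : ℝ → ℝ} (hψc : Continuous ψ)
    (hψ0 : ∀ u, 0 ≤ ψ u) (hψ1 : ∀ u, ψ u ≤ 1) (hψl : ∀ u ≤ 0, ψ u = 1)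
    (hψr : ∀ u, 1 ≤ u → ψ u = 0) {t E : ℝ} (ht : 0 < t)
    (h : ∀ x, |∫ y, ψ ((y - x) / t) ∂ν - ∫ y, ψ ((y - x) / t) ∂(gaussianReal 0 1)| ≤ E) (x : ℝ) :
    |ν.real (Set.Iic x) - (gaussianReal 0 1).real (Set.Iic x)| ≤ t + E := by
  -- The smooth step lies between the indicators of `Iic x` and `Iic (x + t)`; moving `x` by `t`
  -- costs at most `t` under the Gaussian law.
  have key : ∀ (κ : Measure ℝ) [IsProbabilityMeasure κ] (x : ℝ),
      κ.real (Set.Iic x) ≤ ∫ y, ψ ((y - x) / t) ∂κ ∧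
      ∫ y, ψ ((y - x) / t) ∂κ ≤ κ.real (Set.Iic (x + t)) := by
    intro κ _ x
    have hi : Integrable (fun y => ψ ((y - x) / t)) κ := Integrable.of_bound
      (by fun_prop : Continuous fun y => ψ ((y - x) / t)).measurable.aestronglyMeasurable 1
      (ae_of_all _ fun u => by rw [Real.norm_eq_abs, abs_of_nonneg (hψ0 _)]; exact hψ1 _)
    constructor
    · rw [← integral_indicator_one measurableSet_Iic]
      refine integral_mono ((integrable_const (1 : ℝ)).indicator measurableSet_Iic) hi fun y => ?_
      by_cases hy : y ≤ x
      · simp only [Set.indicator, Set.mem_Iic, hy, if_true, Pi.one_apply]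
        rw [hψl _ (div_nonpos_of_nonpos_of_nonneg (by linarith) ht.le)]
      · simp [Set.indicator, hy, hψ0]
    · rw [← integral_indicator_one measurableSet_Iic]
      refine integral_mono hi ((integrable_const (1 : ℝ)).indicator measurableSet_Iic) fun y => ?_
      by_cases hy : y ≤ x + t
      · simp [Set.indicator, hy, hψ1]
      · simp only [Set.indicator, Set.mem_Iic, hy, if_false]
        rw [hψr _ (by rw [one_le_div ht]; linarith)]
  have a1 := key ν x
  have a2 := key ν (x - t)
  have b1 := key (gaussianReal 0 1) x
  have b2 := key (gaussianReal 0 1) (x - t)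
  rw [sub_add_cancel] at a2 b2
  have c1 := abs_le.1 (h x)
  have c2 := abs_le.1 (h (x - t))
  have d1 := gaussianReal_Iic_sub_le (u := x) (v := x + t) (by linarith)
  have d2 := gaussianReal_Iic_sub_le (u := x - t) (v := x) (by linarith)
  rw [abs_le]
  constructor <;> linarith [a1.1, a1.2, a2.1, a2.2, b1.1, b1.2, b2.1, b2.2]

end Kolmogorov

/-! ### Berry–Esseen bound for the tilted laws. -/

namespace SteinExpansion

variable {ν : Measure ℝ} [IsProbabilityMeasure ν] {γ ε ρ : ℝ}

/-- Stein's identity with `f y = y` compares the second moment with `1`. The error is a small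
multiple of the first absolute moment plus a small constant, and the former is absorbed by the
second moment. -/
theorem integral_sq_centredTilt_le (H : SteinExpansion ν γ ε ρ) {a : ℝ} (ha : 0 ≤ a)
    (hs : ε * (1 + a) ^ 2 ≤ 1 / 100) : ∫ y, y ^ 2 ∂(centredTilt ν a) ≤ 2 := by
  have := H.isProbabilityMeasure_centredTilt a
  have hint : ∀ {F : ℝ → ℝ}, Continuous F → Integrable F (centredTilt ν a) := fun hF =>
    integrable_of_continuous_of_ae_abs_le (H.bdd_centredTilt a) hF
  have hε := H.pos
  have hρ := H.le
  have hρ0 := H.nonneg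
  have hγ := H.abs_coeff_le
  have s1 : ε * a ^ 2 ≤ 1 / 100 := le_trans (by gcongr; linarith) hs
  have s2 : ε * (2 * a) ≤ 1 / 100 := le_trans (by gcongr; nlinarith) hs
  have s3 : ε ≤ 1 / 100 := le_trans (le_mul_of_one_le_right hε.le (by nlinarith)) hs
  have s4 : ε * a ≤ 1 := by nlinarith
  have key := H.abs_integral_centredTilt_le ha (by nlinarith) (f := fun y => y) (f1 := fun _ => 1)
    (f2 := fun _ => 0) (f3 := fun _ => 0) (M := fun y => a ^ 3 * (|y| + 1) + 3 * a ^ 2)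
    (fun w => hasDerivAt_id' w) (fun w => hasDerivAt_const w 1) (fun w => hasDerivAt_const w 0)
    (fun y u hu => by
      rw [mul_zero, add_zero, add_zero, mul_one]
      refine (abs_add_le _ _).trans ?_
      rw [abs_mul, abs_of_nonneg (by positivity : (0 : ℝ) ≤ a ^ 3),
        abs_of_nonneg (by positivity : (0 : ℝ) ≤ 3 * a ^ 2)]
      gcongr
      refine (abs_add_le _ _).trans ?_
      linarith) (hint (by fun_prop))
  have hY0 : 0 ≤ ∫ y, y ^ 2 ∂(centredTilt ν a) := integral_nonneg fun y => sq_nonneg y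
  have hA : ∫ y, |y| ∂(centredTilt ν a) ≤ (1 + ∫ y, y ^ 2 ∂(centredTilt ν a)) / 2 := by
    have : ∫ y, |y| ∂(centredTilt ν a) ≤ ∫ y, (1 / 2 + y ^ 2 / 2) ∂(centredTilt ν a) :=
      integral_mono (hint (by fun_prop)) (hint (by fun_prop)) fun y => by
        simp only
        nlinarith [sq_nonneg (|y| - 1), sq_abs y]
    rw [integral_add (hint (by fun_prop)) (hint (by fun_prop))] at this
    simp [integral_div] at this
    linarith
  have hA0 : 0 ≤ ∫ y, |y| ∂(centredTilt ν a) := integral_nonneg fun y => abs_nonneg y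
  have hB : |∫ y, y ∂(centredTilt ν a)| ≤ ∫ y, |y| ∂(centredTilt ν a) :=
    abs_integral_le_integral_abs
  have e1 : ∫ y, (y * y - 1) ∂(centredTilt ν a) = ∫ y, y ^ 2 ∂(centredTilt ν a) - 1 := by
    rw [integral_sub (hint (by fun_prop)) (hint (by fun_prop))]
    simp [pow_two]
  have e2 : ∫ y, (a ^ 2 * y + 2 * a * 1 + 0) ∂(centredTilt ν a) =
      a ^ 2 * ∫ y, y ∂(centredTilt ν a) + 2 * a := by
    rw [integral_add (hint (by fun_prop)) (hint (by fun_prop)),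
      integral_add (hint (by fun_prop)) (hint (by fun_prop)), integral_const_mul]
    simp
  have e3 : ∫ y, (a ^ 3 * (|y| + 1) + 3 * a ^ 2) ∂(centredTilt ν a) =
      a ^ 3 * (∫ y, |y| ∂(centredTilt ν a) + 1) + 3 * a ^ 2 := by
    rw [integral_add (hint (by fun_prop)) (hint (by fun_prop)), integral_const_mul,
      integral_add (hint (by fun_prop)) (hint (by fun_prop))]
    simp
  rw [e1, e2, e3] at key
  set Y := ∫ y, y ^ 2 ∂(centredTilt ν a)
  set Z := ∫ y, |y| ∂(centredTilt ν a)
  have k1 : |a ^ 2 * ∫ y, y ∂(centredTilt ν a) + 2 * a| ≤ a ^ 2 * Z + 2 * a := by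
    refine (abs_add_le _ _).trans ?_
    rw [abs_mul, abs_of_nonneg (by positivity : 0 ≤ a ^ 2),
      abs_of_nonneg (by positivity : 0 ≤ 2 * a)]
    gcongr
  have k2 : |γ| * |a ^ 2 * ∫ y, y ∂(centredTilt ν a) + 2 * a| ≤ 4 * (1 / 100 * Z + 1 / 100) := by
    calc _ ≤ 4 * ε * (a ^ 2 * Z + 2 * a) := by gcongr
      _ = 4 * (ε * a ^ 2 * Z + ε * (2 * a)) := by ring
      _ ≤ _ := by gcongr
  have k3 : 3 * ε ^ 2 * (a ^ 3 * (Z + 1) + 3 * a ^ 2) ≤ 3 * (1 / 100 * (Z + 1) + 3 / 100) := by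
    have q1 : ε ^ 2 * a ^ 3 ≤ 1 / 100 := by
      calc ε ^ 2 * a ^ 3 = (ε * a ^ 2) * (ε * a) := by ring
        _ ≤ 1 / 100 * 1 := by gcongr
        _ = _ := by norm_num
    have q2 : ε ^ 2 * a ^ 2 ≤ 1 / 100 := by
      calc ε ^ 2 * a ^ 2 = (ε * a ^ 2) * ε := by ring
        _ ≤ 1 / 100 * 1 := by gcongr; linarith
        _ = _ := by norm_num
    have : ε ^ 2 * a ^ 3 * (Z + 1) ≤ 1 / 100 * (Z + 1) := by gcongr
    nlinarith
  have := (le_abs_self _).trans key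
  linarith

end SteinExpansion

/-- A pointwise envelope for the third derivative of `exp (a * w) * f (w - a)`, stripped of its
exponential. `F`, `F1`, `F2` stand for the Stein solution and its derivatives at `v`, `G` for the
second derivative of the test function; twice differentiating Stein's equation gives `2 * F1 + v *
F2 + G` as third derivative. -/
theorem abs_third_order_le {a t c χ y v F F1 F2 G : ℝ} (ha : 0 ≤ a) (ht : 0 < t) (ht1 : t ≤ 1)
    (hc : 1 ≤ c) (hχ0 : 0 ≤ χ) (hχ1 : χ ≤ 1) (b0 : |F| ≤ 6) (b1 : |F1| ≤ 7)
    (b2 : |F2| ≤ 7 * (2 + |y|) + c / t * χ) (b3 : |G| ≤ c / t ^ 2 * χ) (hv : |v| ≤ |y| + 1) :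
    |a ^ 3 * F + 3 * a ^ 2 * F1 + 3 * a * F2 + (2 * F1 + v * F2 + G)| ≤
      (105 + 5 * c) * ((1 + a) ^ 3 + (1 + a) * (1 + y ^ 2) / t + χ / t ^ 2) := by
  have hq : 1 ≤ 1 / t := by rw [le_div_iff₀ ht]; linarith
  have hy2 := sq_abs y
  have hy0 := abs_nonneg y
  have b2' : |F2| ≤ (7 * (2 + |y|) + c) * (1 / t) := by
    refine b2.trans ?_
    have e1 : c / t * χ ≤ c * (1 / t) := by
      rw [mul_one_div]
      exact mul_le_of_le_one_right (by positivity) hχ1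
    have e2 : 7 * (2 + |y|) ≤ 7 * (2 + |y|) * (1 / t) :=
      le_mul_of_one_le_right (by positivity) hq
    linarith
  have i1 : |a ^ 3 * F| ≤ 6 * (1 + a) ^ 3 := by
    rw [abs_mul, abs_of_nonneg (by positivity : 0 ≤ a ^ 3), mul_comm]
    gcongr; linarith
  have i2 : |3 * a ^ 2 * F1| ≤ 7 * (1 + a) ^ 3 := by
    rw [abs_mul, abs_of_nonneg (by positivity : 0 ≤ 3 * a ^ 2), mul_comm]
    gcongr
    nlinarith [pow_nonneg ha 3]
  have i3 : |3 * a * F2| ≤ (63 + 3 * c) * ((1 + a) * (1 + y ^ 2) / t) := by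
    rw [abs_mul, abs_of_nonneg (by positivity : 0 ≤ 3 * a)]
    calc _ ≤ 3 * (1 + a) * ((7 * (2 + |y|) + c) * (1 / t)) := by gcongr; linarith
      _ ≤ 3 * (1 + a) * (((21 + c) * (1 + y ^ 2)) * (1 / t)) := by
        gcongr
        nlinarith [sq_nonneg (|y| - 1), mul_nonneg (by linarith : 0 ≤ c) (sq_nonneg y)]
      _ = _ := by ring
  have i4 : |2 * F1 + v * F2 + G| ≤
      (42 + 2 * c) * ((1 + a) * (1 + y ^ 2) / t) + c * (χ / t ^ 2) := by
    have h1 : |2 * F1 + v * F2 + G| ≤ 2 * |F1| + |v| * |F2| + |G| := by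
      have : (2 : ℝ) * |F1| = |2 * F1| := by rw [abs_mul]; simp
      rw [this, ← abs_mul]
      exact (abs_add_le _ _).trans (add_le_add (abs_add_le _ _) le_rfl)
    have h2 : |v| * |F2| ≤ (|y| + 1) * ((7 * (2 + |y|) + c) * (1 / t)) := by gcongr
    have h3 : (|y| + 1) * (7 * (2 + |y|) + c) ≤ (28 + 2 * c) * (1 + y ^ 2) := by
      have k1 : |y| + 1 ≤ 2 * (1 + y ^ 2) := by nlinarith [sq_nonneg (|y| - 1)]
      have k2 : (|y| + 1) * (2 + |y|) ≤ 4 * (1 + y ^ 2) := by nlinarith [sq_nonneg (|y| - 1)]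
      have k3 : c * (|y| + 1) ≤ c * (2 * (1 + y ^ 2)) := by gcongr
      linarith
    have h4 : (14 : ℝ) ≤ 14 * (1 + y ^ 2) * (1 / t) := by
      have : 1 ≤ (1 + y ^ 2) * (1 / t) :=
        one_le_mul_of_one_le_of_one_le (by nlinarith [sq_nonneg y]) hq
      linarith
    calc |2 * F1 + v * F2 + G| ≤ 14 * (1 + y ^ 2) * (1 / t) +
          (28 + 2 * c) * (1 + y ^ 2) * (1 / t) + c / t ^ 2 * χ := by
          have : (|y| + 1) * ((7 * (2 + |y|) + c) * (1 / t)) ≤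
              (28 + 2 * c) * (1 + y ^ 2) * (1 / t) := by
            rw [← mul_assoc]; gcongr
          linarith
      _ = (42 + 2 * c) * (1 * (1 + y ^ 2) / t) + c * (χ / t ^ 2) := by ring
      _ ≤ _ := by gcongr; linarith
  have P1 : 0 ≤ (1 + a) ^ 3 := by positivity
  have P2 : 0 ≤ (1 + a) * (1 + y ^ 2) / t := by positivity
  have P3 : 0 ≤ χ / t ^ 2 := by positivity
  have Q1 := mul_nonneg (by linarith : 0 ≤ c) P1
  have Q3 := mul_nonneg (by linarith : 0 ≤ c) P3
  calc _ ≤ |a ^ 3 * F| + |3 * a ^ 2 * F1| + |3 * a * F2| + |2 * F1 + v * F2 + G| :=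
        (abs_add_le _ _).trans (add_le_add ((abs_add_le _ _).trans
          (add_le_add (abs_add_le _ _) le_rfl)) le_rfl)
    _ ≤ _ := by linarith

namespace SteinExpansion

variable {ν : Measure ℝ} [IsProbabilityMeasure ν] {γ ε ρ : ℝ}

/-- Stein's equation for the smooth step is inserted into the identity for the tilt. The derivatives
of the step, of sizes `1 / t` and `1 / t ^ 2`, live on an interval of length `t`, so those factors
come weighted by the probability `p` of a slightly larger interval. -/
theorem abs_integral_smooth_sub_le (H : SteinExpansion ν γ ε ρ) {a : ℝ} (ha : 0 ≤ a)
    (hs : ε * (1 + a) ^ 2 ≤ 1 / 100) {c : ℝ} {ψ ψ1 ψ2 : ℝ → ℝ} (hc : 1 ≤ c)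
    (hd : ∀ u, HasDerivAt ψ (ψ1 u) u) (hd1 : ∀ u, HasDerivAt ψ1 (ψ2 u) u)
    (hψ0 : ∀ u, 0 ≤ ψ u) (hψ1 : ∀ u, ψ u ≤ 1) (hb1 : ∀ u, |ψ1 u| ≤ c) (hb2 : ∀ u, |ψ2 u| ≤ c)
    (hs1 : ∀ u ∉ Set.Icc (0 : ℝ) 1, ψ1 u = 0) (hs2 : ∀ u ∉ Set.Icc (0 : ℝ) 1, ψ2 u = 0)
    {x t p : ℝ} (ht : 0 < t) (ht1 : t ≤ 1)
    (hp : (centredTilt ν a).real (Set.Icc (x - ρ) (x + t + ρ)) ≤ p) :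
    |∫ y, ψ ((y - x) / t) ∂(centredTilt ν a) - ∫ y, ψ ((y - x) / t) ∂(gaussianReal 0 1)| ≤
      4 * ε * (25 * (1 + a) ^ 2 + c / t * p) + 3 * ε ^ 2 * ((105 + 5 * c) *
        ((1 + a) ^ 3 + 3 * (1 + a) / t + p / t ^ 2)) := by
  have := H.isProbabilityMeasure_centredTilt a
  have hint : ∀ {F : ℝ → ℝ}, Continuous F → Integrable F (centredTilt ν a) := fun hF =>
    integrable_of_continuous_of_ae_abs_le (H.bdd_centredTilt a) hF
  have hε := H.pos
  have hρ := H.le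
  have hρ0 := H.nonneg
  have hγ := H.abs_coeff_le
  have hY := H.integral_sq_centredTilt_le ha hs
  have s3 : ε ≤ 1 / 100 := le_trans (le_mul_of_one_le_right hε.le (by nlinarith)) hs
  have s4 : ε * a ≤ 1 := by nlinarith
  have hψc : Continuous ψ := continuous_iff_continuousAt.2 fun w => (hd w).continuousAt
  have hψ1c : Continuous ψ1 := continuous_iff_continuousAt.2 fun w => (hd1 w).continuousAt
  set h : ℝ → ℝ := fun y => ψ ((y - x) / t) with hh
  set h' : ℝ → ℝ := fun y => ψ1 ((y - x) / t) / t with hh'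
  set h'' : ℝ → ℝ := fun y => ψ2 ((y - x) / t) / t ^ 2 with hh''
  have hL : ∀ y, HasDerivAt (fun y => (y - x) / t) (1 / t) y := fun y =>
    ((hasDerivAt_id' y).sub_const x).div_const t
  have dh : ∀ y, HasDerivAt h (h' y) y := fun y =>
    ((hd ((y - x) / t)).comp y (hL y)).congr_deriv (by simp only [hh']; ring)
  have dh' : ∀ y, HasDerivAt h' (h'' y) y := fun y =>
    (((hd1 ((y - x) / t)).comp y (hL y)).div_const t).congr_deriv (by
      simp only [hh'']; field_simp)
  have hhc : Continuous h := by fun_prop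
  obtain ⟨f, df, fb, wfb⟩ := exists_stein_solution hhc (fun y => hψ0 _) (fun y => hψ1 _)
  set κ := ∫ y, h y ∂(gaussianReal 0 1) with hκ
  have hhi : Integrable h (gaussianReal 0 1) := Integrable.of_bound
    hhc.measurable.aestronglyMeasurable 1 (ae_of_all _ fun u => by
      rw [Real.norm_eq_abs, abs_of_nonneg (hψ0 _)]; exact hψ1 _)
  have hκ0 : 0 ≤ κ := integral_nonneg fun y => hψ0 _
  have hκ1 : κ ≤ 1 := by
    have := integral_mono hhi (integrable_const (1 : ℝ)) fun y => hψ1 _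
    simpa using this
  set f1 : ℝ → ℝ := fun y => y * f y + h y - κ with hf1
  set f2 : ℝ → ℝ := fun y => f y + y * f1 y + h' y with hf2
  set f3 : ℝ → ℝ := fun y => 2 * f1 y + y * f2 y + h'' y with hf3
  have df1 : ∀ y, HasDerivAt f1 (f2 y) y := fun y =>
    ((((hasDerivAt_id' y).fun_mul (df y)).fun_add (dh y)).sub_const κ).congr_deriv (by
      simp only [hf2]; ring)
  have df2 : ∀ y, HasDerivAt f2 (f3 y) y := fun y =>
    (((df y).fun_add ((hasDerivAt_id' y).fun_mul (df1 y))).fun_add (dh' y)).congr_deriv (by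
      simp only [hf3, hf1]; ring)
  have f1b : ∀ y, |f1 y| ≤ 7 := fun y => by
    have h1 := abs_le.1 (wfb y)
    have h2 : 0 ≤ h y := hψ0 _
    have h3 : h y ≤ 1 := hψ1 _
    rw [abs_le]; constructor <;> simp only [hf1] <;> linarith
  -- The support is enlarged by `ρ` because the envelope at `y` must dominate all shifts `y + u`
  -- with `|u| ≤ ρ`.
  set S := Set.Icc (x - ρ) (x + t + ρ) with hS
  set χ : ℝ → ℝ := S.indicator 1 with hχ
  have hχ0 : ∀ y, 0 ≤ χ y := fun y => Set.indicator_nonneg (fun _ _ => zero_le_one) y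
  have hχi : Integrable χ (centredTilt ν a) :=
    (integrable_const (1 : ℝ)).indicator measurableSet_Icc
  have hχp : ∫ y, χ y ∂(centredTilt ν a) ≤ p := by
    rw [hχ, integral_indicator_one measurableSet_Icc]; exact hp
  have hmem : ∀ y u, |u| ≤ ρ → y ∉ S → (y + u - x) / t ∉ Set.Icc (0 : ℝ) 1 := by
    intro y u hu hy hm
    apply hy
    have := abs_le.1 hu
    have h1 : 0 ≤ y + u - x := by
      have := mul_nonneg hm.1 ht.le
      rwa [div_mul_cancel₀ _ ht.ne'] at this
    have h2 := (div_le_one ht).1 hm.2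
    exact ⟨by linarith, by linarith⟩
  have h'b : ∀ y u, |u| ≤ ρ → |h' (y + u)| ≤ c / t * χ y := by
    intro y u hu
    by_cases hy : y ∈ S
    · simp only [hχ, hh', Set.indicator_of_mem hy, Pi.one_apply, mul_one, abs_div, abs_of_pos ht]
      gcongr; exact hb1 _
    · simp [hh', hs1 _ (hmem y u hu hy), hχ, hy]
  have h''b : ∀ y u, |u| ≤ ρ → |h'' (y + u)| ≤ c / t ^ 2 * χ y := by
    intro y u hu
    by_cases hy : y ∈ S
    · simp only [hχ, hh'', Set.indicator_of_mem hy, Pi.one_apply, mul_one, abs_div,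
        abs_of_pos (pow_pos ht 2)]
      gcongr; exact hb2 _
    · simp [hh'', hs2 _ (hmem y u hu hy), hχ, hy]
  have hχ1 : ∀ y, χ y ≤ 1 := fun y => Set.indicator_le' (fun _ _ => le_rfl)
    (fun _ _ => zero_le_one) y
  have f2b : ∀ y u, |u| ≤ ρ → |f2 (y + u)| ≤ 7 * (2 + |y|) + c / t * χ y := by
    intro y u hu
    have h1 : |f2 (y + u)| ≤ |f (y + u)| + |y + u| * |f1 (y + u)| + |h' (y + u)| := by
      rw [← abs_mul]
      exact (abs_add_le _ _).trans (add_le_add (abs_add_le _ _) le_rfl)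
    have h2 : |y + u| ≤ |y| + 1 := (abs_add_le _ _).trans (by linarith)
    have h3 : |y + u| * |f1 (y + u)| ≤ (|y| + 1) * 7 := by gcongr; exact f1b _
    have := fb (y + u)
    have := h'b y u hu
    linarith
  set K := 105 + 5 * c with hK
  have hMint : Integrable (fun y => K * ((1 + a) ^ 3 + (1 + a) * (1 + y ^ 2) / t + χ y / t ^ 2))
      (centredTilt ν a) :=
    ((hint (by fun_prop)).add (hχi.div_const _)).const_mul K
  have key := H.abs_integral_centredTilt_le ha (by nlinarith) df df1 df2 (f1 := f1)
    (M := fun y => K * ((1 + a) ^ 3 + (1 + a) * (1 + y ^ 2) / t + χ y / t ^ 2))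
    (fun y u hu => abs_third_order_le ha ht ht1 hc (hχ0 y) (hχ1 y) (fb _) (f1b _) (f2b y u hu)
      (h''b y u hu) ((abs_add_le _ _).trans (by linarith))) hMint
  have e0 : ∫ y, (y * f y - f1 y) ∂(centredTilt ν a) =
      -(∫ y, h y ∂(centredTilt ν a) - κ) := by
    have : ∀ y, y * f y - f1 y = κ - h y := fun y => by simp only [hf1]; ring
    simp_rw [this]
    rw [integral_sub (integrable_const _) (hint hhc)]
    simp
  rw [e0, abs_neg] at key
  have hf : Continuous f := continuous_iff_continuousAt.2 fun w => (df w).continuousAt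
  have hf1c : Continuous f1 := continuous_iff_continuousAt.2 fun w => (df1 w).continuousAt
  have hf2c : Continuous f2 := continuous_iff_continuousAt.2 fun w => (df2 w).continuousAt
  have m1 : |∫ y, (a ^ 2 * f y + 2 * a * f1 y + f2 y) ∂(centredTilt ν a)| ≤
      25 * (1 + a) ^ 2 + c / t * p := by
    have h1 : |∫ y, (a ^ 2 * f y + 2 * a * f1 y + f2 y) ∂(centredTilt ν a)| ≤
        ∫ y, ((7 * (1 + a) ^ 2 + 11 + 7 / 2 * y ^ 2) + c / t * χ y) ∂(centredTilt ν a) := by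
      have hi : Integrable (fun y => (7 * (1 + a) ^ 2 + 11 + 7 / 2 * y ^ 2) + c / t * χ y)
          (centredTilt ν a) := (hint (by fun_prop)).add (hχi.const_mul _)
      refine norm_integral_le_of_norm_le (f := fun y => a ^ 2 * f y + 2 * a * f1 y + f2 y) hi
        (ae_of_all _ fun y => ?_)
      have b0 := fb y
      have b1 := f1b y
      have b2 := f2b y 0 (by simpa using hρ0)
      rw [add_zero] at b2
      have j1 : |a ^ 2 * f y| ≤ a ^ 2 * 7 := by
        rw [abs_mul, abs_of_nonneg (by positivity : 0 ≤ a ^ 2)]; gcongr; linarith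
      have j2 : |2 * a * f1 y| ≤ 2 * a * 7 := by
        rw [abs_mul, abs_of_nonneg (by positivity : 0 ≤ 2 * a)]; gcongr
      have j3 : |a ^ 2 * f y + 2 * a * f1 y + f2 y| ≤
          |a ^ 2 * f y| + |2 * a * f1 y| + |f2 y| :=
        (abs_add_le _ _).trans (add_le_add (abs_add_le _ _) le_rfl)
      have j4 := sq_abs y
      rw [Real.norm_eq_abs]
      nlinarith [sq_nonneg (|y| - 1)]
    have e : ∫ y, ((7 * (1 + a) ^ 2 + 11 + 7 / 2 * y ^ 2) + c / t * χ y) ∂(centredTilt ν a) =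
        7 * (1 + a) ^ 2 + 11 + 7 / 2 * (∫ y, y ^ 2 ∂(centredTilt ν a)) +
          c / t * ∫ y, χ y ∂(centredTilt ν a) := by
      rw [integral_add (hint (by fun_prop)) (hχi.const_mul _),
        integral_add (hint (by fun_prop)) (hint (by fun_prop)), integral_const_mul,
        integral_const_mul]
      simp
    rw [e] at h1
    have h2 : c / t * ∫ y, χ y ∂(centredTilt ν a) ≤ c / t * p := by gcongr
    nlinarith
  have m2 : ∫ y, K * ((1 + a) ^ 3 + (1 + a) * (1 + y ^ 2) / t + χ y / t ^ 2) ∂(centredTilt ν a) ≤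
      K * ((1 + a) ^ 3 + 3 * (1 + a) / t + p / t ^ 2) := by
    have hK0 : 0 ≤ K := by positivity
    rw [integral_const_mul]
    gcongr
    rw [integral_add (hint (by fun_prop)) (hχi.div_const _), integral_div,
      integral_add (hint (by fun_prop)) (hint (by fun_prop)), integral_div, integral_const_mul,
      integral_add (hint (by fun_prop)) (hint (by fun_prop))]
    simp only [integral_const, probReal_univ, one_smul]
    rw [mul_comm 3 (1 + a)]
    gcongr
    linarith
  refine key.trans (add_le_add (mul_le_mul hγ m1 (abs_nonneg _) (by positivity)) ?_)
  gcongr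

/-- A Berry–Esseen bound for the centred exponential tilts. -/
theorem exists_kolmogorov_bound : ∃ C δ : ℝ, 0 < C ∧ 0 < δ ∧
    ∀ (ν : Measure ℝ) [IsProbabilityMeasure ν] (γ ε ρ : ℝ), SteinExpansion ν γ ε ρ →
      ∀ a, 0 ≤ a → ε * (1 + a) ^ 2 ≤ δ → ∀ x,
        |(centredTilt ν a).real (Set.Iic x) - (gaussianReal 0 1).real (Set.Iic x)| ≤
          C * (ε * (1 + a) ^ 2) := by
  obtain ⟨c, ψ, ψ1, ψ2, hc, hd, hd1, hψ0, hψ1, hψl, hψr, hb1, hb2, hs1, hs2⟩ :=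
    exists_smooth_step
  set K := 105 + 5 * c with hK
  -- The smoothing scale will be `L * ε`; this `L` makes the coefficient `8 c / L + 6 K / L²` of the
  -- distance `η` at most `1 / 2`, and `ε ≤ 1 / L` keeps the scale below `1`.
  set L := 32 * c + 24 * K with hL
  have hK0 : 0 < K := by positivity
  have hL1 : 1 ≤ L := by rw [hL]; nlinarith
  have hL0 : 0 < L := by positivity
  have hψc : Continuous ψ := continuous_iff_continuousAt.2 fun w => (hd w).continuousAt
  refine ⟨2 * (L + 100 + 12 * c + 21 * K), min (1 / 100) (1 / L), by positivity,
    by positivity, ?_⟩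
  intro ν _ γ ε ρ H a ha hs
  have hε := H.pos
  have hρ := H.le
  have hρ0 := H.nonneg
  have hs' := hs.trans (min_le_left _ _)
  have hsL := hs.trans (min_le_right _ _)
  have := H.isProbabilityMeasure_centredTilt a
  set D : ℝ → ℝ := fun x =>
    |(centredTilt ν a).real (Set.Iic x) - (gaussianReal 0 1).real (Set.Iic x)| with hD
  have hD1 : ∀ x, D x ≤ 1 := fun x => by
    have h1 := measureReal_le_one (μ := centredTilt ν a) (s := Set.Iic x)
    have h2 := measureReal_le_one (μ := gaussianReal 0 1) (s := Set.Iic x)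
    have h3 := measureReal_nonneg (μ := centredTilt ν a) (s := Set.Iic x)
    have h4 := measureReal_nonneg (μ := gaussianReal 0 1) (s := Set.Iic x)
    simp only [hD]
    rw [abs_le]; constructor <;> linarith
  have hbdd : BddAbove (Set.range D) := ⟨1, by rintro _ ⟨x, rfl⟩; exact hD1 x⟩
  set η := ⨆ x, D x with hη
  have hDη : ∀ x, D x ≤ η := fun x => le_ciSup hbdd x
  have hη0 : 0 ≤ η := (abs_nonneg _).trans (hDη 0)
  have ha1 : 1 ≤ (1 + a) ^ 2 := by nlinarith
  have hεL : L * ε ≤ 1 := by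
    have : ε ≤ 1 / L := le_trans (le_mul_of_one_le_right hε.le ha1) hsL
    rw [le_div_iff₀ hL0] at this
    linarith
  have ht : 0 < L * ε := by positivity
  have step : ∀ x, D x ≤ (L + 100 + 12 * c + 21 * K) * (ε * (1 + a) ^ 2) + η / 2 := by
    intro x
    -- The interval has length at most `L * ε + 2 * ρ ≤ 3 * (L * ε)`, which with the concentration
    -- estimate gives this `p`.
    refine (abs_measureReal_Iic_sub_le_of_smooth hψc hψ0 hψ1 hψl hψr ht (fun x =>
      H.abs_integral_smooth_sub_le ha hs' hc hd hd1 hψ0 hψ1 hb1 hb2 hs1 hs2 ht hεL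
      (p := 3 * (L * ε) + 2 * η)
      ((measureReal_Icc_le hDη (by linarith)).trans ?_)) x).trans ?_
    · nlinarith
    · have e : L * ε + (4 * ε * (25 * (1 + a) ^ 2 + c / (L * ε) * (3 * (L * ε) + 2 * η)) +
          3 * ε ^ 2 * (K * ((1 + a) ^ 3 + 3 * (1 + a) / (L * ε) +
            (3 * (L * ε) + 2 * η) / (L * ε) ^ 2))) =
          L * ε + 100 * (ε * (1 + a) ^ 2) + 12 * c * ε +
          3 * K * (ε * (1 + a)) * (ε * (1 + a) ^ 2) + 9 * K * (ε * (1 + a) / L) +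
          9 * K * (ε / L) + (8 * c / L + 6 * K / L ^ 2) * η := by
        field_simp; ring
      rw [e]
      have q1 : ε ≤ ε * (1 + a) ^ 2 := le_mul_of_one_le_right hε.le ha1
      have q2 : ε * (1 + a) ≤ ε * (1 + a) ^ 2 := by gcongr; nlinarith
      have q3 : ε * (1 + a) ≤ 1 := by linarith
      have q4 : ε * (1 + a) / L ≤ ε * (1 + a) ^ 2 := (div_le_self (by positivity) hL1).trans q2
      have q5 : ε / L ≤ ε * (1 + a) ^ 2 := (div_le_self (by positivity) hL1).trans q1
      have q6 : 8 * c / L + 6 * K / L ^ 2 ≤ 1 / 2 := by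
        have : 8 * c / L ≤ 1 / 4 := by rw [div_le_iff₀ hL0]; linarith
        have : 6 * K / L ^ 2 ≤ 1 / 4 := by
          rw [div_le_iff₀ (by positivity)]; nlinarith
        linarith
      have r1 : L * ε ≤ L * (ε * (1 + a) ^ 2) := by gcongr
      have r2 : 12 * c * ε ≤ 12 * c * (ε * (1 + a) ^ 2) := by gcongr
      have r3 : 3 * K * (ε * (1 + a)) * (ε * (1 + a) ^ 2) ≤ 3 * K * 1 * (ε * (1 + a) ^ 2) := by
        gcongr
      have r4 : 9 * K * (ε * (1 + a) / L) ≤ 9 * K * (ε * (1 + a) ^ 2) := by gcongr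
      have r5 : 9 * K * (ε / L) ≤ 9 * K * (ε * (1 + a) ^ 2) := by gcongr
      have r6 : (8 * c / L + 6 * K / L ^ 2) * η ≤ 1 / 2 * η := by gcongr
      linarith
  -- Taking the supremum closes the self-bounding inequality; `η` is finite, so `η / 2` can be
  -- absorbed.
  have hfin : η ≤ (L + 100 + 12 * c + 21 * K) * (ε * (1 + a) ^ 2) + η / 2 := ciSup_le step
  intro x
  have := hDη x
  linarith

end SteinExpansion

/-! ### Laplace transforms on the half-line and Gaussian tails. -/

section LaplaceTransform

/-- The function `y ↦ exp (-a y)` on the positive half-line, extended by zero. -/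
noncomputable def halfExp (a : ℝ) : ℝ → ℝ := (Set.Ioi 0).indicator fun y => Real.exp (-(a * y))

theorem measurable_halfExp (a : ℝ) : Measurable (halfExp a) :=
  (by fun_prop : Continuous fun y => Real.exp (-(a * y))).measurable.indicator measurableSet_Ioi

theorem halfExp_nonneg (a y : ℝ) : 0 ≤ halfExp a y :=
  Set.indicator_nonneg (fun _ _ => (Real.exp_pos _).le) y

theorem halfExp_le_one {a : ℝ} (ha : 0 ≤ a) (y : ℝ) : halfExp a y ≤ 1 := by
  refine Set.indicator_le' (fun y hy => ?_) (fun _ _ => zero_le_one) y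
  rw [Real.exp_le_one_iff, neg_nonpos]
  exact mul_nonneg ha (le_of_lt hy)

/-- Layer-cake formula: the superlevel sets of `halfExp a` are intervals starting at `0`. Hence
Kolmogorov bounds transfer to the transform uniformly in `a`. -/
theorem integral_halfExp_eq (κ : Measure ℝ) [IsProbabilityMeasure κ] {a : ℝ} (ha : 0 < a) :
    IntegrableOn (fun t => κ.real (Set.Ioc 0 (-Real.log t / a))) (Set.Ioc 0 1) ∧
      ∫ y, halfExp a y ∂κ = ∫ t in Set.Ioc 0 1, κ.real (Set.Ioc 0 (-Real.log t / a)) := by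
  have hi : Integrable (halfExp a) κ := Integrable.of_bound
    (measurable_halfExp a).aestronglyMeasurable 1 (ae_of_all _ fun y => by
      rw [Real.norm_eq_abs, abs_of_nonneg (halfExp_nonneg a y)]; exact halfExp_le_one ha.le y)
  have hset : ∀ t ∈ Set.Ioc (0 : ℝ) 1,
      {y | t ≤ halfExp a y} = Set.Ioc 0 (-Real.log t / a) := by
    intro t ht
    ext y
    by_cases hy : 0 < y
    · simp only [halfExp, Set.indicator, Set.mem_Ioi, hy, if_true, Set.mem_ofPred_eq, Set.mem_Ioc,
        true_and]
      rw [le_div_iff₀ ha, ← Real.log_le_iff_le_exp ht.1]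
      constructor <;> intro h <;> linarith
    · simp [halfExp, hy, ht.1]
  have hanti : Antitone fun t => κ.real {y | t ≤ halfExp a y} := fun s t hst =>
    measureReal_mono fun y hy => hst.trans hy
  have hint : IntegrableOn (fun t => κ.real {y | t ≤ halfExp a y}) (Set.Ioc 0 1) :=
    Measure.integrableOn_of_bounded (M := 1) (by simp) hanti.measurable.aestronglyMeasurable
      (ae_of_all _ fun t => by
        rw [Real.norm_eq_abs, abs_of_nonneg measureReal_nonneg]; exact measureReal_le_one)
  refine ⟨hint.congr_fun (fun t ht => by simp only [hset t ht]) measurableSet_Ioc, ?_⟩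
  rw [hi.integral_eq_integral_meas_le (ae_of_all _ (halfExp_nonneg a))]
  rw [setIntegral_eq_of_subset_of_forall_sdiff_eq_zero measurableSet_Ioi Set.Ioc_subset_Ioi_self]
  · exact setIntegral_congr_fun measurableSet_Ioc fun t ht => by simp only [hset t ht]
  · intro t ht
    have h1 : 1 < t := by
      by_contra hc
      exact ht.2 ⟨ht.1, not_lt.1 hc⟩
    have : {y | t ≤ halfExp a y} = ∅ := by
      ext y
      simp only [Set.mem_ofPred_eq, Set.mem_empty_iff_false, iff_false, not_le]
      exact (halfExp_le_one ha.le y).trans_lt h1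
    simp [this]

/-- Comparison of the Laplace transforms of the positive parts of two laws. -/
theorem abs_integral_halfExp_sub_le {κ κ' : Measure ℝ} [IsProbabilityMeasure κ]
    [IsProbabilityMeasure κ'] {η : ℝ}
    (h : ∀ x, |κ.real (Set.Iic x) - κ'.real (Set.Iic x)| ≤ η) {a : ℝ} (ha : 0 < a) :
    |∫ y, halfExp a y ∂κ - ∫ y, halfExp a y ∂κ'| ≤ 2 * η := by
  obtain ⟨i1, e1⟩ := integral_halfExp_eq κ ha
  obtain ⟨i2, e2⟩ := integral_halfExp_eq κ' ha
  rw [e1, e2, ← integral_sub i1 i2]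
  have := norm_setIntegral_le_of_norm_le_const (μ := volume) (s := Set.Ioc (0 : ℝ) 1)
    (C := 2 * η) (f := fun t => κ.real (Set.Ioc 0 (-Real.log t / a)) -
      κ'.real (Set.Ioc 0 (-Real.log t / a))) (by simp) (fun t ht => by
    have h0 : 0 ≤ -Real.log t / a :=
      div_nonneg (neg_nonneg.2 (Real.log_nonpos ht.1.le ht.2)) ha.le
    rw [← Set.Iic_sdiff_Iic, measureReal_sdiff (Set.Iic_subset_Iic.2 h0) measurableSet_Iic,
      measureReal_sdiff (Set.Iic_subset_Iic.2 h0) measurableSet_Iic, Real.norm_eq_abs]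
    have h1 := abs_le.1 (h (-Real.log t / a))
    have h2 := abs_le.1 (h 0)
    rw [abs_le]; constructor <;> linarith)
  simpa using this

theorem gaussianReal_real_Ioi (z : ℝ) : (gaussianReal 0 1).real (Set.Ioi z) =
    (√(2 * Real.pi))⁻¹ * ∫ u in Set.Ioi z, Real.exp (-u ^ 2 / 2) := by
  rw [← integral_indicator_one measurableSet_Ioi, integral_gaussianReal_std,
    ← integral_indicator measurableSet_Ioi]
  refine congrArg _ (integral_congr_ae (ae_of_all _ fun u => ?_))
  by_cases hu : z < u <;> simp [Set.indicator, hu]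

/-- Complete the square and translate by `a`. -/
theorem integral_halfExp_gaussianReal (a : ℝ) : ∫ y, halfExp a y ∂(gaussianReal 0 1) =
    Real.exp (a ^ 2 / 2) * (gaussianReal 0 1).real (Set.Ioi a) := by
  rw [gaussianReal_real_Ioi, integral_gaussianReal_std, mul_left_comm]
  refine congrArg _ ?_
  rw [← integral_const_mul, ← integral_indicator measurableSet_Ioi,
    ← integral_add_right_eq_self ((Set.Ioi a).indicator _) a]
  refine integral_congr_ae (ae_of_all _ fun u => ?_)
  by_cases hu : 0 < u
  · simp only [halfExp, Set.indicator, Set.mem_Ioi, hu, if_true, lt_add_iff_pos_left]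
    rw [← Real.exp_add, ← Real.exp_add]; congr 1; ring
  · simp [halfExp, Set.indicator, hu]

/-- On `(z, z + 1 / z]` one has `u ^ 2 ≤ z ^ 2 + 3`, so this piece of length `1 / z` already
suffices. -/
theorem exists_mills_lower : ∃ c : ℝ, 0 < c ∧ ∀ z : ℝ, 1 ≤ z →
    c ≤ z * (Real.exp (z ^ 2 / 2) * (gaussianReal 0 1).real (Set.Ioi z)) := by
  refine ⟨(√(2 * Real.pi))⁻¹ * Real.exp (-3 / 2), by positivity, fun z hz => ?_⟩
  have hz0 : 0 < z := by linarith
  have h1 : 1 / z * Real.exp (-(z ^ 2 + 3) / 2) ≤ ∫ u in Set.Ioi z, Real.exp (-u ^ 2 / 2) := by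
    have e : ∫ u in Set.Ioc z (z + 1 / z), Real.exp (-(z ^ 2 + 3) / 2) =
        1 / z * Real.exp (-(z ^ 2 + 3) / 2) := by
      rw [setIntegral_const]
      simp [measureReal_def, hz0.le]
    rw [← e]
    calc _ ≤ ∫ u in Set.Ioc z (z + 1 / z), Real.exp (-u ^ 2 / 2) := by
          refine setIntegral_mono_on (integrableOn_const (by simp))
            integrable_exp_neg_sq_div_two.integrableOn measurableSet_Ioc fun u hu => ?_
          refine Real.exp_le_exp.2 ?_
          have h2 : u ^ 2 ≤ (z + 1 / z) ^ 2 := by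
            have := hu.1
            have := hu.2
            gcongr; linarith
          have h3 : (z + 1 / z) ^ 2 = z ^ 2 + 2 + (1 / z) ^ 2 := by field_simp; ring
          have h4 : (1 / z) ^ 2 ≤ 1 := pow_le_one₀ (by positivity) (by
            rw [div_le_one hz0]; exact hz)
          linarith
      _ ≤ _ := setIntegral_mono_set integrable_exp_neg_sq_div_two.integrableOn
          (ae_of_all _ fun u => (Real.exp_pos _).le) Set.Ioc_subset_Ioi_self.eventuallyLE
  rw [gaussianReal_real_Ioi]
  calc (√(2 * Real.pi))⁻¹ * Real.exp (-3 / 2)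
      = z * (Real.exp (z ^ 2 / 2) * ((√(2 * Real.pi))⁻¹ *
          (1 / z * Real.exp (-(z ^ 2 + 3) / 2)))) := by
        rw [show (-3 / 2 : ℝ) = z ^ 2 / 2 + -(z ^ 2 + 3) / 2 by ring, Real.exp_add]
        field_simp
    _ ≤ _ := by gcongr

theorem abs_exp_sub_one_le_mul (x : ℝ) : |Real.exp x - 1| ≤ |x| * Real.exp |x| := by
  have h1 := Real.add_one_le_exp x
  have h2 := Real.add_one_le_exp (-x)
  have h3 : Real.exp x * Real.exp (-x) = 1 := by rw [← Real.exp_add]; simp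
  have h4 := Real.exp_pos x
  have h5 : Real.exp x - 1 ≤ x * Real.exp x := by nlinarith
  rcases le_total 0 x with hx | hx
  · rw [abs_of_nonneg hx, abs_of_nonneg (by linarith)]; exact h5
  · have h6 : 1 ≤ Real.exp |x| := Real.one_le_exp (abs_nonneg x)
    have h7 : Real.exp x ≤ 1 := Real.exp_le_one_iff.2 hx
    rw [abs_of_nonpos (by linarith : Real.exp x - 1 ≤ 0)]
    have : |x| ≤ |x| * Real.exp |x| := le_mul_of_one_le_right (abs_nonneg x) h6
    rw [abs_of_nonpos hx] at this ⊢
    linarith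

/-- The tilting weight cancels `exp (-a (w - a))` up to the constant `exp (a ^ 2)`, leaving the tail
probability. -/
theorem integral_halfExp_centredTilt (ν : Measure ℝ) (a : ℝ) : ∫ y, halfExp a y ∂(centredTilt ν a) =
    Real.exp (a ^ 2) * ν.real (Set.Ioi a) / ∫ w, Real.exp (a * w) ∂ν := by
  rw [integral_centredTilt, ← integral_indicator_one measurableSet_Ioi, ← integral_const_mul]
  congr 2; ext w
  by_cases hw : a < w
  · simp only [halfExp, Set.indicator, Set.mem_Ioi, hw, sub_pos, if_true, Pi.one_apply, mul_one]
    rw [← Real.exp_add]; congr 1; ring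
  · simp [halfExp, Set.indicator, hw]

end LaplaceTransform

/-! ### Moderate deviations. -/

namespace SteinExpansion

variable {ν : Measure ℝ} [IsProbabilityMeasure ν] {γ ε ρ : ℝ}

/-- The logarithmic derivative at `s` is `s + O(ε s²)`, and this is integrated over `[0, a]`. The
constant `7` is `4` from `|γ| ≤ 4 * ε` plus `3` from the remainder, using `ε * s ≤ 1`. -/
theorem abs_log_mgf_sub_le (H : SteinExpansion ν γ ε ρ) {a : ℝ} (ha : 0 ≤ a) (hεa : ε * a ≤ 1) :
    |Real.log (∫ w, Real.exp (a * w) ∂ν) - a ^ 2 / 2| ≤ 7 * ε * a ^ 3 := by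
  have hε := H.pos
  have hρ := H.le
  have hρ0 := H.nonneg
  have hγ := H.abs_coeff_le
  have hmem : ∀ s : ℝ, s ∈ interior (integrableExpSet (fun w : ℝ => w) ν) := fun s => by
    have : integrableExpSet (fun w : ℝ => w) ν = Set.univ :=
      Set.eq_univ_of_forall fun s => H.integrable_exp s
    simp [this]
  have hd : ∀ s, HasDerivAt (fun s => ∫ w, Real.exp (s * w) ∂ν)
      (∫ w, w * Real.exp (s * w) ∂ν) s := fun s => hasDerivAt_mgf (hmem s)
  have hd2 : ∀ s, HasDerivAt (fun s => Real.log (∫ w, Real.exp (s * w) ∂ν) - s ^ 2 / 2)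
      ((∫ w, w * Real.exp (s * w) ∂ν) / (∫ w, Real.exp (s * w) ∂ν) - s) s := fun s =>
    (((hd s).log (H.mgf_pos s).ne').fun_sub (((hasDerivAt_id' s).fun_pow 2).div_const 2)).congr_deriv
      (by simp)
  have hb : ∀ s ∈ Set.Icc 0 a,
      ‖(∫ w, w * Real.exp (s * w) ∂ν) / (∫ w, Real.exp (s * w) ∂ν) - s‖ ≤ 7 * ε * a ^ 2 := by
    intro s hs
    have hs0 := hs.1
    have hsa := hs.2
    have hφ := H.mgf_pos s
    have hεs : ε * s ≤ 1 := le_trans (by gcongr) hεa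
    have key := H.abs_mgf_deriv_sub_le (a := s) (by rw [abs_of_nonneg hs0]; nlinarith)
    rw [abs_of_nonneg hs0] at key
    set φ := ∫ w, Real.exp (s * w) ∂ν
    set I := ∫ w, w * Real.exp (s * w) ∂ν
    have h1 : |I - s * φ| ≤ 7 * ε * s ^ 2 * φ := by
      have h2 : |γ * (s ^ 2 * φ)| ≤ 4 * ε * (s ^ 2 * φ) := by
        rw [abs_mul, abs_of_nonneg (by positivity : 0 ≤ s ^ 2 * φ)]; gcongr
      have h3 : ε ^ 2 * (3 * s ^ 3 * φ) ≤ 3 * ε * s ^ 2 * φ := by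
        calc _ = 3 * ε * s ^ 2 * φ * (ε * s) := by ring
          _ ≤ 3 * ε * s ^ 2 * φ * 1 := by gcongr
          _ = _ := by ring
      have := abs_sub_abs_le_abs_sub (I - s * φ) (γ * (s ^ 2 * φ))
      linarith
    have e : I / φ - s = (I - s * φ) / φ := by field_simp
    rw [e, Real.norm_eq_abs, abs_div, abs_of_pos hφ, div_le_iff₀ hφ]
    refine h1.trans ?_
    gcongr
  have := (convex_Icc 0 a).norm_image_sub_le_of_norm_hasDerivWithin_le
    (fun s _ => (hd2 s).hasDerivWithinAt) hb (Set.left_mem_Icc.2 ha) (Set.right_mem_Icc.2 ha)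
  simp only [zero_mul, Real.exp_zero, integral_const, probReal_univ, one_smul, Real.log_one,
    sub_zero, Real.norm_eq_abs, abs_of_nonneg ha] at this
  refine le_trans (le_of_eq ?_) (this.trans (le_of_eq (by ring)))
  congr 1; ring

/-- A moderate deviation bound. -/
theorem exists_moderate_bound (R : ℝ) : ∃ C K : ℝ, 0 < C ∧ 1 ≤ K ∧
    ∀ (ν : Measure ℝ) [IsProbabilityMeasure ν] (γ ε ρ : ℝ), SteinExpansion ν γ ε ρ →
      ∀ z, K ≤ z → ε * z ^ 3 ≤ R →
        |ν.real (Set.Ioi z) / (gaussianReal 0 1).real (Set.Ioi z) - 1| ≤ C * (ε * z ^ 3) := by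
  obtain ⟨C1, δ, hC1, hδ, hK⟩ := exists_kolmogorov_bound
  obtain ⟨c, hc, hmills⟩ := exists_mills_lower
  -- For large `z`, `z ≥ R` gives `ε * z ≤ 1`, and `z ≥ 4 * R / δ` brings `ε * (1 + z) ^ 2` below
  -- the threshold of the Berry–Esseen bound.
  refine ⟨Real.exp (7 * R) * (7 + 8 * C1 / c), max 1 (max R (4 * R / δ)), by positivity,
    le_max_left _ _, ?_⟩
  intro ν _ γ ε ρ H z hz hεz
  have hε := H.pos
  have hz1 : 1 ≤ z := (le_max_left _ _).trans hz
  have hz2 : R ≤ z := ((le_max_left _ _).trans (le_max_right _ _)).trans hz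
  have hz3 : 4 * R / δ ≤ z := ((le_max_right _ _).trans (le_max_right _ _)).trans hz
  have hz0 : 0 < z := by linarith
  have hεz1 : ε * z ≤ 1 := by
    have h1 : ε * z * z ^ 2 ≤ z := by linarith [show ε * z * z ^ 2 = ε * z ^ 3 by ring]
    have h2 : z ≤ z ^ 2 := by nlinarith
    have h3 : 0 < z ^ 2 := by positivity
    exact le_of_mul_le_mul_right (by linarith) h3
  have h4 : ε * (1 + z) ^ 2 ≤ 4 * (ε * z ^ 2) := by
    calc ε * (1 + z) ^ 2 ≤ ε * (2 * z) ^ 2 := by gcongr; linarith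
      _ = _ := by ring
  have hsmall : ε * (1 + z) ^ 2 ≤ δ := by
    rw [div_le_iff₀ hδ] at hz3
    have h5 : 4 * (ε * z ^ 2) * z ≤ δ * z := by
      linarith [show 4 * (ε * z ^ 2) * z = 4 * (ε * z ^ 3) by ring]
    exact h4.trans (le_of_mul_le_mul_right h5 hz0)
  have := H.isProbabilityMeasure_centredTilt z
  have hdiff := abs_integral_halfExp_sub_le (hK ν γ ε ρ H z hz0.le hsmall) hz0
  rw [integral_halfExp_centredTilt, integral_halfExp_gaussianReal] at hdiff
  have hφ := H.mgf_pos z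
  have hlog := H.abs_log_mgf_sub_le hz0.le hεz1
  have hm := hmills z hz1
  set φ := ∫ w, Real.exp (z * w) ∂ν
  set G := (gaussianReal 0 1).real (Set.Ioi z)
  set Q := ν.real (Set.Ioi z)
  set x := Real.log φ - z ^ 2 / 2 with hx
  have hφx : φ = Real.exp x * Real.exp (z ^ 2 / 2) := by
    rw [← Real.exp_add, hx, sub_add_cancel, Real.exp_log hφ]
  set J := Real.exp (z ^ 2 / 2) * G with hJ
  have hJ0 : 0 < J := pos_of_mul_pos_right (hc.trans_le hm) hz0.le
  have hG0 : 0 < G := pos_of_mul_pos_right hJ0 (Real.exp_pos _).le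
  set θ := Real.exp (z ^ 2) * Q / φ - J with hθ
  -- Here `exp x` is the error in the moment generating function and `θ / J` the relative error in
  -- the Laplace transform.
  have hratio : Q / G = Real.exp x * (1 + θ / J) := by
    have e1 : 1 + θ / J = (Real.exp (z ^ 2) * Q / φ) / J := by rw [hθ]; field_simp; ring
    have e2 : Real.exp (z ^ 2) = Real.exp (z ^ 2 / 2) * Real.exp (z ^ 2 / 2) := by
      rw [← Real.exp_add]; congr 1; ring
    rw [e1, hφx, hJ, e2]
    have := Real.exp_pos x
    have := Real.exp_pos (z ^ 2 / 2)
    field_simp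
  -- The absolute error of order `ε z²` is divided by `J ≥ c / z`, which produces the third power of
  -- `z`.
  have hy : |θ / J| ≤ 8 * C1 / c * (ε * z ^ 3) := by
    rw [abs_div, abs_of_pos hJ0, div_le_iff₀ hJ0]
    calc |θ| ≤ 2 * (C1 * (ε * (1 + z) ^ 2)) := hdiff
      _ ≤ 2 * (C1 * (4 * (ε * z ^ 2))) := by gcongr
      _ = 8 * C1 / c * (ε * z ^ 2) * c := by field_simp; ring
      _ ≤ 8 * C1 / c * (ε * z ^ 2) * (z * J) := by gcongr
      _ = _ := by ring
  have hxR : |x| ≤ 7 * (ε * z ^ 3) := by rw [← mul_assoc]; exact hlog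
  have hex : Real.exp |x| ≤ Real.exp (7 * R) := Real.exp_le_exp.2 (by linarith)
  have hex' : Real.exp x ≤ Real.exp (7 * R) := (Real.exp_le_exp.2 (le_abs_self x)).trans hex
  rw [hratio]
  calc |Real.exp x * (1 + θ / J) - 1| = |(Real.exp x - 1) + Real.exp x * (θ / J)| := by
        congr 1; ring
    _ ≤ |x| * Real.exp |x| + Real.exp x * |θ / J| := by
        refine (abs_add_le _ _).trans (add_le_add (abs_exp_sub_one_le_mul x) ?_)
        rw [abs_mul, Real.abs_exp]
    _ ≤ 7 * (ε * z ^ 3) * Real.exp (7 * R) +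
          Real.exp (7 * R) * (8 * C1 / c * (ε * z ^ 3)) := by gcongr
    _ = _ := by ring

end SteinExpansion

/-! ### From dependency graphs to the expansion. -/

/-- The expansion of Stein's operator for a normalised sum of locally dependent variables. -/
theorem LocallyDependent.exists_steinExpansion {V : Type*} [Fintype V] [DecidableEq V]
    {μ : Measure (V → ℝ)} [IsProbabilityMeasure μ] {A : V → Finset V} {m : ℕ} {b ε : ℝ}
    (H : LocallyDependent μ A m b) (hvar : ∫ x, (∑ k, x k) ^ 2 ∂μ = 1) (hε : 0 < ε)
    (hmb : 3 * m * b ≤ ε) (hε2 : 28 * Fintype.card V * m ^ 3 * b ^ 4 ≤ ε ^ 2) :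
    ∃ γ, SteinExpansion (μ.map fun x => ∑ k, x k) γ ε (3 * m * b) := by
  have hb := H.nonneg
  have hw : Measurable fun x : V → ℝ => ∑ k, x k := by fun_prop
  obtain ⟨γ, hγ⟩ := H.exists_stein_expansion
  refine ⟨γ, ⟨⟨Fintype.card V * b, ?_⟩, ?_, hε, by positivity, hmb, ?_⟩⟩
  · refine (ae_map_iff hw.aemeasurable (measurableSet_le (by fun_prop) (by fun_prop))).2 ?_
    filter_upwards [ae_all_iff.2 H.bound] with x hx
    calc |∑ k, x k| ≤ ∑ k, |x k| := Finset.abs_sum_le_sum_abs _ _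
      _ ≤ ∑ _k : V, b := Finset.sum_le_sum fun k _ => hx k
      _ = _ := by simp
  · rw [integral_map hw.aemeasurable (by fun_prop),
      integral_finsetSum _ fun k _ => H.integrable (by fun_prop)]
    simp [H.mean]
  · intro g g1 g2 g3 M h h1 h2 hM hMi
    have hg : Continuous g := continuous_iff_continuousAt.2 fun w => (h w).continuousAt
    have hg1 : Continuous g1 := continuous_iff_continuousAt.2 fun w => (h1 w).continuousAt
    have hg2 : Continuous g2 := continuous_iff_continuousAt.2 fun w => (h2 w).continuousAt
    have hMi' := (integrable_map_measure hMi.1 hw.aemeasurable).1 hMi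
    have hM0 : ∀ w, 0 ≤ M w := fun w => (abs_nonneg _).trans (hM w 0 (by simp; positivity))
    rw [integral_map hw.aemeasurable (by fun_prop), integral_map hw.aemeasurable (by fun_prop),
      integral_map hw.aemeasurable (by fun_prop), integral_map hw.aemeasurable hMi.1]
    have key := hγ g g1 g2 g3 M (3 * m * b) h h1 h2 le_rfl hM hMi'
    rw [hvar, one_mul] at key
    refine key.trans ?_
    have : 0 ≤ ∫ x, M (∑ k, x k) ∂μ := integral_nonneg fun x => hM0 _
    gcongr

theorem measurable_list_prod_map {α ι : Type*} [MeasurableSpace α] (l : List ι) {f : ι → α → ℝ}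
    (hf : ∀ i, Measurable (f i)) : Measurable fun y => (l.map fun i => f i y).prod := by
  induction l with
  | nil => simp
  | cons i l ih => simp only [List.map_cons, List.prod_cons]; exact (hf i).mul ih

/-- The closed neighbourhood of a vertex. -/
def closedNbhd {V : Type*} [Fintype V] [DecidableEq V] (G : SimpleGraph V) [DecidableRel G.Adj]
    (i : V) : Finset V := insert i (G.neighborFinset i)

theorem integral_sq_sum_map {Ω V : Type*} [MeasurableSpace Ω] {P : Measure Ω}
    [IsProbabilityMeasure P] [Fintype V] {X : V → Ω → ℝ} {B : ℝ} (hX : ∀ i, Measurable (X i))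
    (hmean : ∀ i, ∫ ω, X i ω ∂P = 0) (hb : ∀ i, ∀ᵐ ω ∂P, |X i ω| ≤ B) (hσ : 0 < sumStdDev P X) :
    ∫ x, (∑ k, x k) ^ 2 ∂(P.map fun ω i => X i ω / sumStdDev P X) = 1 := by
  have hm : Measurable fun ω i => X i ω / sumStdDev P X :=
    measurable_pi_lambda _ fun i => (hX i).div_const _
  rw [integral_map hm.aemeasurable (by fun_prop)]
  have hS : Measurable fun ω => ∑ i, X i ω := by fun_prop
  have h0 : ∫ ω, ∑ i, X i ω ∂P = 0 := by
    rw [integral_finsetSum _ fun k _ => Integrable.of_bound (hX k).aestronglyMeasurable B (hb k)]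
    simp [hmean]
  have hv := variance_of_integral_eq_zero hS.aemeasurable h0
  have hσ2 : sumStdDev P X ^ 2 = ∫ ω, (∑ i, X i ω) ^ 2 ∂P := by
    rw [sumStdDev, Real.sq_sqrt (variance_nonneg _ _), hv]
  simp only [← Finset.sum_div, div_pow]
  rw [integral_div, ← hσ2, div_self (by positivity)]

section DependencyGraph

variable {Ω V : Type*} [MeasurableSpace Ω] {P : Measure Ω}
  [Fintype V] [DecidableEq V] {G : SimpleGraph V} [DecidableRel G.Adj] {X : V → Ω → ℝ} {B : ℝ}

/-- The vertices of the list and those outside their closed neighbourhoods are disjoint and joined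
by no edge. Both factors are measurable functions of the corresponding subfamilies, written with an
extension by zero. -/
theorem integral_prod_mul_comp_sub (hX : ∀ i, Measurable (X i))
    (hG : IsDependencyGraph P G X) (σ : ℝ) (l : List V) {g : ℝ → ℝ} (hg : Continuous g) :
    ∫ ω, (l.map fun i => X i ω / σ).prod *
      g (∑ k, X k ω / σ - ∑ k ∈ listNbhd (closedNbhd G) l, X k ω / σ) ∂P =
    (∫ ω, (l.map fun i => X i ω / σ).prod ∂P) *
      ∫ ω, g (∑ k, X k ω / σ - ∑ k ∈ listNbhd (closedNbhd G) l, X k ω / σ) ∂P := by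
  set N := listNbhd (closedNbhd G) l with hN
  have hmem : ∀ i ∈ l, ∀ k, (k = i ∨ G.Adj i k) → k ∈ N := fun i hi k hk => by
    simp only [hN, listNbhd, closedNbhd, Finset.mem_biUnion, List.mem_toFinset]
    exact ⟨i, hi, by simpa using hk⟩
  have hind := hG {i | i ∈ l} {k | k ∉ N}
    (Set.disjoint_left.2 fun i hi hi' => hi' (hmem i hi i (Or.inl rfl)))
    (fun i hi j hj hij => hj (hmem i hi j (Or.inr hij)))
  have hf1 : Measurable fun y : {i | i ∈ l} → ℝ =>
      (l.map fun i => if h : i ∈ l then y ⟨i, h⟩ / σ else 0).prod := by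
    refine measurable_list_prod_map l fun i => ?_
    by_cases h : i ∈ l
    · simp only [h, dite_true]; fun_prop
    · simp [h]
  have hf2 : Measurable fun y : {k | k ∉ N} → ℝ =>
      g (∑ k, if h : k ∉ N then y ⟨k, h⟩ / σ else 0) := by
    refine hg.measurable.comp (Finset.measurable_fun_sum _ fun k _ => ?_)
    by_cases h : k ∉ N
    · simp only [h, not_false_eq_true, dite_true]; fun_prop
    · simp only [h, dite_false]; exact measurable_const
  have key := hind.comp hf1 hf2
  have m1 : Measurable fun ω => fun i : {i | i ∈ l} => X i ω :=
    measurable_pi_lambda _ fun i => hX i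
  have m2 : Measurable fun ω => fun k : {k | k ∉ N} => X k ω :=
    measurable_pi_lambda _ fun i => hX i
  have e := key.integral_fun_mul_eq_mul_integral (hf1.comp m1).aestronglyMeasurable
    (hf2.comp m2).aestronglyMeasurable
  have e1 : ∀ ω, (l.map fun i => if _h : i ∈ l then X i ω / σ else 0).prod =
      (l.map fun i => X i ω / σ).prod := fun ω => by
    congr 1
    exact List.map_congr_left fun i hi => by simp [hi]
  have e2 : ∀ ω, (∑ k, if _h : k ∉ N then X k ω / σ else 0) =
      ∑ k, X k ω / σ - ∑ k ∈ N, X k ω / σ := fun ω => by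
    rw [eq_sub_iff_add_eq, ← Finset.sum_compl_add_sum N fun k => X k ω / σ]
    simp only [dite_eq_ite]
    rw [← Finset.sum_filter]
    congr 2
    ext k; simp
  simpa only [Function.comp_apply, e1, e2] using e

/-- The vertex itself is absorbed into the factor `2`, because `posMaxDegree` is at least `1`. -/
theorem card_closedNbhd_le (i : V) : (closedNbhd G i).card ≤ 2 * posMaxDegree G := by
  have h1 : (closedNbhd G i).card ≤ G.degree i + 1 := Finset.card_insert_le _ _
  have h2 := G.degree_le_maxDegree i
  have h3 : G.maxDegree ≤ posMaxDegree G := le_max_left _ _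
  have h4 : 1 ≤ posMaxDegree G := le_max_right _ _
  omega

theorem locallyDependent_map (hX : ∀ i, Measurable (X i)) (hG : IsDependencyGraph P G X)
    (hmean : ∀ i, ∫ ω, X i ω ∂P = 0) (hb : ∀ i, ∀ᵐ ω ∂P, |X i ω| ≤ B) {σ : ℝ} (hσ : 0 < σ)
    (hB : 0 ≤ B) :
    LocallyDependent (P.map fun ω i => X i ω / σ) (closedNbhd G) (2 * posMaxDegree G) (B / σ) := by
  have hm : Measurable fun ω i => X i ω / σ := measurable_pi_lambda _ fun i => (hX i).div_const σ
  refine ⟨by positivity, fun i => ?_, fun i => ?_, card_closedNbhd_le, fun l g hg => ?_⟩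
  · refine (ae_map_iff hm.aemeasurable (measurableSet_le (by fun_prop) (by fun_prop))).2 ?_
    filter_upwards [hb i] with ω hω
    rw [abs_div, abs_of_pos hσ]
    gcongr
  · rw [integral_map hm.aemeasurable (measurable_pi_apply i).aestronglyMeasurable, integral_div,
      hmean, zero_div]
  · have hp := LocallyDependent.continuous_prod l
    have hc : Continuous fun x : V → ℝ =>
        g (∑ k, x k - ∑ k ∈ listNbhd (closedNbhd G) l, x k) := by fun_prop
    rw [integral_map hm.aemeasurable (hp.fun_mul hc).aestronglyMeasurable,
      integral_map hm.aemeasurable hp.aestronglyMeasurable,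
      integral_map hm.aemeasurable hc.aestronglyMeasurable]
    exact integral_prod_mul_comp_sub hX hG σ l hg

end DependencyGraph

/-! ### Rates and conclusion. -/

theorem uniformRate_sq (B σ : ℝ) (n D : ℕ) :
    uniformRate B σ n D ^ 2 = n * D ^ 3 * (B / σ) ^ 4 := by
  have h1 : ((n : ℝ) ^ (1 / 2 : ℝ)) ^ 2 = n := by
    rw [← Real.rpow_natCast, ← Real.rpow_mul (by positivity)]; norm_num
  have h2 : ((D : ℝ) ^ (3 / 2 : ℝ)) ^ 2 = (D : ℝ) ^ 3 := by
    rw [← Real.rpow_natCast, ← Real.rpow_mul (by positivity), ← Real.rpow_natCast]; norm_num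
  rw [uniformRate, mul_pow, mul_pow, h1, h2]
  ring

theorem uniformRate_nonneg (B σ : ℝ) (n D : ℕ) : 0 ≤ uniformRate B σ n D := by
  unfold uniformRate; positivity

theorem centredTilt_zero (ν : Measure ℝ) [IsProbabilityMeasure ν] : centredTilt ν 0 = ν := by
  simp [centredTilt]

/-- This is the tilted bound at `a = 0`; for `ε > δ` the term `1 / δ * ε` exceeds `1` and the claim
is trivial. -/
theorem exists_uniform_bound : ∃ C : ℝ, 0 < C ∧
    ∀ (ν : Measure ℝ) [IsProbabilityMeasure ν] (γ ε ρ : ℝ), SteinExpansion ν γ ε ρ →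
      ∀ z, |ν.real (Set.Iic z) - (gaussianReal 0 1).real (Set.Iic z)| ≤ C * ε := by
  obtain ⟨C, δ, hC, hδ, h⟩ := SteinExpansion.exists_kolmogorov_bound
  refine ⟨C + 1 / δ, by positivity, fun ν _ γ ε ρ H z => ?_⟩
  have hε := H.pos
  by_cases hs : ε ≤ δ
  · have := h ν γ ε ρ H 0 le_rfl (by simpa using hs) z
    rw [centredTilt_zero] at this
    refine this.trans ?_
    have : 0 ≤ 1 / δ * ε := by positivity
    simp only [add_zero, one_pow, mul_one]
    linarith
  · have h1 := measureReal_le_one (μ := ν) (s := Set.Iic z)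
    have h2 := measureReal_le_one (μ := gaussianReal 0 1) (s := Set.Iic z)
    have h3 := measureReal_nonneg (μ := ν) (s := Set.Iic z)
    have h4 := measureReal_nonneg (μ := gaussianReal 0 1) (s := Set.Iic z)
    have h5 : 1 ≤ 1 / δ * ε := by
      rw [one_div_mul_eq_div, one_le_div hδ]; exact (not_le.1 hs).le
    have h6 : 0 ≤ C * ε := by positivity
    rw [abs_le]; constructor <;> linarith

theorem one_sub_stdNormalCDF (z : ℝ) :
    1 - stdNormalCDF z = (gaussianReal 0 1).real (Set.Ioi z) := by
  rw [stdNormalCDF, cdf_eq_real, ← Set.compl_Iic, probReal_compl_eq_one_sub measurableSet_Iic]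

theorem theorem3p5 :
    ∃ C : ℝ, 0 < C ∧
      ∀ (Ω : Type*) [MeasurableSpace Ω] (P : Measure Ω) [IsProbabilityMeasure P]
        (V : Type*) [Fintype V] (G : SimpleGraph V) [DecidableRel G.Adj]
        (X : V → Ω → ℝ) (B : ℝ),
        (∀ i, Measurable (X i)) →
        IsDependencyGraph P G X →
        (∀ i, ∫ ω, X i ω ∂P = 0) →
        (∀ i, ∀ᵐ ω ∂P, |X i ω| ≤ B) →
        0 < sumStdDev P X →
        (∀ z : ℝ,
          |P.real {ω | normalizedSum P X ω ≤ z} - stdNormalCDF z| ≤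
            C * uniformRate B (sumStdDev P X) (Fintype.card V) (posMaxDegree G)) ∧
        (∀ z : ℝ, 0 ≤ z →
          moderateRate B (sumStdDev P X) (Fintype.card V) (posMaxDegree G) z ≤ 1 →
          |P.real {ω | z < normalizedSum P X ω} / (1 - stdNormalCDF z) - 1| ≤
            C * moderateRate B (sumStdDev P X) (Fintype.card V) (posMaxDegree G) z) := by
  obtain ⟨C1, hC1, huni⟩ := exists_uniform_bound
  -- The value `30` is `15 * 2`: below, `ε = 15 * r`, and `r * z ^ 3` is at most twice the moderate
  -- rate, hence at most `2`.
  obtain ⟨C2, K, hC2, hK1, hmod⟩ := SteinExpansion.exists_moderate_bound 30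
  obtain ⟨c, hc, hmills⟩ := exists_mills_lower
  have hGpos : 0 < (gaussianReal 0 1).real (Set.Ioi K) :=
    pos_of_mul_pos_right (pos_of_mul_pos_right (hc.trans_le (hmills K hK1)) (by linarith))
      (Real.exp_pos _).le
  set g0 := (gaussianReal 0 1).real (Set.Ioi K)
  -- The summands serve the uniform bound, the tail for `z ≤ K` and the tail for `z ≥ K`.
  refine ⟨15 * C1 + 15 * C1 / g0 + 30 * C2, by positivity, ?_⟩
  intro Ω _ P _ V _ G _ X B hX hG hmean hb hσ
  classical
  set σ := sumStdDev P X with hσdef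
  set n := Fintype.card V
  set D := posMaxDegree G
  have hV : Nonempty V := by
    by_contra hV
    rw [not_nonempty_iff] at hV
    have h0 : (fun ω => ∑ i, X i ω) = 0 := by ext ω; simp
    have : σ = 0 := by rw [hσdef, sumStdDev, h0, variance_zero, Real.sqrt_zero]
    exact hσ.ne' this
  have hB : 0 ≤ B := by
    obtain ⟨ω, hω⟩ := (hb hV.some).exists
    exact (abs_nonneg _).trans hω
  have hm : Measurable fun ω i => X i ω / σ := measurable_pi_lambda _ fun i => (hX i).div_const σ
  have hw : Measurable fun x : V → ℝ => ∑ k, x k := by fun_prop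
  have hP1 := Measure.isProbabilityMeasure_map (μ := P) hm.aemeasurable
  have hLD := locallyDependent_map hX hG hmean hb hσ hB
  have hvar := integral_sq_sum_map hX hmean hb hσ
  rw [← hσdef] at hvar
  set μ := P.map fun ω i => X i ω / σ
  have hP2 := Measure.isProbabilityMeasure_map (μ := μ) hw.aemeasurable
  have hr2 := uniformRate_sq B σ n D
  have hr0 := uniformRate_nonneg B σ n D
  set r := uniformRate B σ n D
  set b := B / σ with hbdef
  have hb0 : 0 ≤ b := by positivity
  -- Unit variance bounds `n * D * b ^ 2` from below; multiplying by this factor raises powers in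
  -- the comparisons with `r` and `q`.
  have hone : 1 ≤ n * (2 * D * b ^ 2) := by
    have := hLD.integral_sq_sum_le
    rw [hvar] at this
    simpa using this
  have hDb : (D * b) ^ 2 ≤ 2 * r ^ 2 := by
    rw [hr2]
    calc (D * b) ^ 2 = (D * b) ^ 2 * 1 := by ring
      _ ≤ (D * b) ^ 2 * (n * (2 * D * b ^ 2)) := by gcongr
      _ = _ := by ring
  have hrpos : 0 < r := by
    rcases hr0.lt_or_eq with h | h
    · exact h
    · exfalso
      rw [← h] at hDb
      have h1 : (D * b) ^ 2 = 0 := le_antisymm (by simpa using hDb) (sq_nonneg _)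
      have h2 : D * b = 0 := by simpa using h1
      have h3 : (n : ℝ) * (2 * D * b ^ 2) = 2 * n * b * (D * b) := by ring
      rw [h3, h2] at hone
      norm_num at hone
  -- With `m = 2 * D` the remainder is `28 * 8 * r ^ 2 = 224 * r ^ 2 ≤ (15 * r) ^ 2`, and the window
  -- is `6 * (D * b) ≤ 12 * r`.
  obtain ⟨γ, hS⟩ := hLD.exists_steinExpansion (ε := 15 * r) hvar (by positivity)
    (by
      push_cast
      have : D * b ≤ 2 * r := abs_le_of_sq_le_sq' (by nlinarith) (by positivity) |>.2
      linarith)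
    (by
      push_cast
      have : 28 * n * (2 * D) ^ 3 * b ^ 4 = 224 * (n * D ^ 3 * b ^ 4) := by ring
      rw [this, ← hr2]
      nlinarith [sq_nonneg r])
  have hU := huni _ γ _ _ hS
  have hM := hmod _ γ _ _ hS
  have hmapI : ∀ s : Set ℝ, MeasurableSet s → (μ.map fun x => ∑ k, x k).real s =
      P.real {ω | normalizedSum P X ω ∈ s} := fun s hs => by
    rw [map_measureReal_apply hw hs, map_measureReal_apply hm (hw hs)]
    rfl
  have hIic := fun z => hmapI (Set.Iic z) measurableSet_Iic
  have hIoi := fun z => hmapI (Set.Ioi z) measurableSet_Ioi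
  simp only [Set.mem_Iic, Set.mem_Ioi] at hIic hIoi
  set ν := μ.map fun x => ∑ k, x k
  refine ⟨fun z => ?_, fun z hz hθ => ?_⟩
  · rw [← hIic, stdNormalCDF, cdf_eq_real]
    refine (hU z).trans ?_
    have : 0 ≤ (15 * C1 / g0 + 30 * C2) * r := by positivity
    linarith
  · rw [← hIoi, one_sub_stdNormalCDF]
    set q := n * D ^ 2 * b ^ 3 with hq
    have hq0 : 0 ≤ q := by positivity
    have hθe : moderateRate B σ n D z = (r + q * z) * (1 + z ^ 2) := by
      simp only [moderateRate, hq, hbdef]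
      congr 2
      field_simp
    rw [hθe] at hθ ⊢
    have hrq : r ≤ 2 * q := by
      refine abs_le_of_sq_le_sq' ?_ (by positivity) |>.2
      have : r ^ 2 ≤ 2 * q ^ 2 := by
        rw [hr2, hq]
        calc n * D ^ 3 * b ^ 4 = n * D ^ 3 * b ^ 4 * 1 := by ring
          _ ≤ n * D ^ 3 * b ^ 4 * (n * (2 * D * b ^ 2)) := by gcongr
          _ = _ := by ring
      nlinarith [sq_nonneg q]
    have hθ0 : 0 ≤ (r + q * z) * (1 + z ^ 2) := by positivity
    rcases le_total K z with hKz | hzK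
    -- Because `r ≤ 2 * q`, the error `r * z ^ 3` is covered by the term `q * z ^ 3` of the rate.
    · have h1 : r * z ^ 3 ≤ 2 * ((r + q * z) * (1 + z ^ 2)) := by
        have e1 : r * z ^ 3 ≤ 2 * q * z ^ 3 := by gcongr
        have e2 : (r + q * z) * (1 + z ^ 2) = r * (1 + z ^ 2) + q * z + q * z ^ 3 := by ring
        have e3 : 0 ≤ r * (1 + z ^ 2) + q * z := by positivity
        rw [e2]; linarith
      refine (hM z hKz (by linarith)).trans ?_
      have e4 : C2 * (15 * r * z ^ 3) ≤ 30 * C2 * ((r + q * z) * (1 + z ^ 2)) := by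
        calc _ = 15 * C2 * (r * z ^ 3) := by ring
          _ ≤ 15 * C2 * (2 * ((r + q * z) * (1 + z ^ 2))) := by gcongr
          _ = _ := by ring
      have : 0 ≤ (15 * C1 + 15 * C1 / g0) * ((r + q * z) * (1 + z ^ 2)) := by positivity
      linarith
    -- For bounded `z` the Gaussian tail is at least `g0`, so the uniform bound gives a relative
    -- one.
    · have hg : g0 ≤ (gaussianReal 0 1).real (Set.Ioi z) :=
        measureReal_mono (Set.Ioi_subset_Ioi hzK)
      have hg' := hGpos.trans_le hg
      have hrθ : r ≤ (r + q * z) * (1 + z ^ 2) := by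
        have e : (r + q * z) * (1 + z ^ 2) = r + (r * z ^ 2 + q * z * (1 + z ^ 2)) := by ring
        have : 0 ≤ r * z ^ 2 + q * z * (1 + z ^ 2) := by positivity
        linarith
      have hsub : |ν.real (Set.Ioi z) - (gaussianReal 0 1).real (Set.Ioi z)| ≤ C1 * (15 * r) := by
        rw [← Set.compl_Iic, probReal_compl_eq_one_sub measurableSet_Iic,
          probReal_compl_eq_one_sub measurableSet_Iic, abs_sub_comm]
        simpa using hU z
      rw [div_sub_one hg'.ne', abs_div, abs_of_pos hg']
      calc _ ≤ C1 * (15 * r) / g0 := by gcongr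
        _ = 15 * C1 / g0 * r := by ring
        _ ≤ 15 * C1 / g0 * ((r + q * z) * (1 + z ^ 2)) := by gcongr
        _ ≤ _ := by
          have : 0 ≤ (15 * C1 + 30 * C2) * ((r + q * z) * (1 + z ^ 2)) := by positivity
          linarith
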